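/- Let $n\ge 3$ and let $G$ be a dihedral group of order $2n$. A sequence over $G$ is a finite multiset of elements of $G$; its length $|S|$ is the number of its terms counted with multiplicity. Sequences are multiplied (concatenated) by $\boldsymbol\cdot$, and $g^{[k]}$ denotes the sequence consisting of $k$ copies of $g$. A sequence is a product-one sequence if its terms can be ordered so that their product in $G$ is $1_G$. Let $\mathsf s(G)$ (respectively $\mathsf E(G)$) be the smallest integer $\ell$ such that every sequence over $G$ of length at least $\ell$ has a product-one subsequence of length $\exp(G)=\operatorname{lcm}\{\operatorname{ord}(g) : g\in G\}$ (respectively of length $|G|$). 1. Suppose that $n$ is even (so $n\ge 4$). Then $\exp(G)=n$ and $\mathsf s(G)=2n$, and for every sequence $S$ over $G$ the following are equivalent: (a) $|S|=\mathsf s(G)-1$ and $S$ has no product-one subsequence of length $\exp(G)=n$. (b) There exist $\alpha,\tau\in G$ with $G=\langle \alpha,\tau \mid \alpha^n=\tau^2=1_G,\ \tau\alpha=\alpha^{-1}\tau\rangle$ and $r_1,r_2,r_3\in[0,n-1]$ with $\gcd(r_1-r_2,n)=1$ such that $S=(\alpha^{r_1})^{[n-1]}\boldsymbol\cdot(\alpha^{r_2})^{[n-1]}\boldsymbol\cdot\alpha^{r_3}\tau$.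 2. For all $n\ge 3$ we have $|G|=2n$ and $\mathsf E(G)=3n$, and for every sequence $S$ over $G$ the following are equivalent: (a) $|S|=\mathsf E(G)-1$ and $S$ has no product-one subsequence of length $|G|=2n$. (b) There exist $\alpha,\tau\in G$ with $G=\langle \alpha,\tau \mid \alpha^n=\tau^2=1_G,\ \tau\alpha=\alpha^{-1}\tau\rangle$ such that one of the following holds: (i) $n\ge4$ and $S=(\alpha^{r_1})^{[2n-1]}\boldsymbol\cdot(\alpha^{r_2})^{[n-1]}\boldsymbol\cdot\alpha^{r_3}\tau$ for some $r_1,r_2,r_3\in[0,n-1]$ with $\gcd(r_1-r_2,n)=1$; (ii) $n=3$, and either $S=1_G^{[5]}\boldsymbol\cdot\tau\boldsymbol\cdot\alpha\tau\boldsymbol\cdot\alpha^2\tau$, or $S=(\alpha^{t_1})^{[5]}\boldsymbol\cdot(\alpha^{t_2})^{[2]}\boldsymbol\cdot\alpha^{t_3}\tau$ for some $t_1,t_2,t_3\in[0,2]$ with $\gcd(t_1-t_2,3)=1$. -/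

import Mathlib

/-- A (finite, unordered) sequence over a group `G`, repetitions allowed, is a `Multiset G`.
It is a product-one sequence if its terms can be ordered so that their product is `1`
(the empty sequence is product-one). -/
def IsProductOne {G : Type*} [Group G] (S : Multiset G) : Prop :=
  ∃ l : List G, (l : Multiset G) = S ∧ l.prod = 1

/-- `S` has a product-one subsequence of length `k`. -/
def HasProductOneSubseq {G : Type*} [Group G] (S : Multiset G) (k : ℕ) : Prop :=
  ∃ T : Multiset G, T ≤ S ∧ T.card = k ∧ IsProductOne T

/-- The invariant `s(G)`: the smallest `ℓ` such that every sequence over `G` of length at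
least `ℓ` has a product-one subsequence of length `exp(G)`. -/
noncomputable def egzS (G : Type*) [Group G] : ℕ :=
  sInf {ℓ : ℕ | ∀ S : Multiset G, ℓ ≤ S.card → HasProductOneSubseq S (Monoid.exponent G)}

/-- The invariant `E(G)`: the smallest `ℓ` such that every sequence over `G` of length at
least `ℓ` has a product-one subsequence of length `|G|`. -/
noncomputable def egzE (G : Type*) [Group G] : ℕ :=
  sInf {ℓ : ℕ | ∀ S : Multiset G, ℓ ≤ S.card → HasProductOneSubseq S (Nat.card G)}

/-- The relators of `⟨a, t | a ^ n = t ^ 2 = 1, t a = a⁻¹ t⟩` in the free group on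
`a = of 0` and `t = of 1`. -/
def dihedralRels (n : ℕ) : Set (FreeGroup (Fin 2)) :=
  {FreeGroup.of 0 ^ n, FreeGroup.of 1 ^ 2,
    (FreeGroup.of 1 * FreeGroup.of 0) * ((FreeGroup.of 0)⁻¹ * FreeGroup.of 1)⁻¹}

/-- `G = ⟨α, τ | α ^ n = τ ^ 2 = 1, τ α = α⁻¹ τ⟩`: the elements `α, τ` present `G` by these
relations, that is, the presented group is isomorphic to `G` by an isomorphism that sends the
two standard generators to `α` and `τ`. -/
def IsDihedralPresentation {G : Type*} [Group G] (n : ℕ) (α τ : G) : Prop :=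
  ∃ f : PresentedGroup (dihedralRels n) ≃* G,
    f (PresentedGroup.of 0) = α ∧ f (PresentedGroup.of 1) = τ

/-! Both parts are one statement about length `2 * k` and threshold `n + 2 * k`: `n = 2 * k` gives
the exponent, `n = k` the group order. A sequence is split into the exponents `A` of its rotations
and `B` of its reflections. A reflection inverts every rotation moved past it. So once a reflection
is present, a product of one follows if signs can be put on the rotations freely, and on the
reflections half plus and half minus, with total zero (`SignedZeroSum.isProductOne`).

With at most one reflection only rotations matter, by parity, and the Erdős–Ginzburg–Ziv theorem and
its inverse for `ZMod n` decide everything; this yields the main extremal family.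

With two or more reflections a signed zero-sum of the right length exists, apart from `n = 3`
(`hasSigned_of_two_le_card`). Rotations that agree up to sign, and equal reflections, form pairs
contributing zero, usable as padding. If there are fewer than `k` such pairs, the unpaired terms are
so many that pigeonhole gives relations among four of them. If there are at least `k`, it remains to
involve a reflection. The hard case has few, distinct reflections: there the Kemperman–Scherk bound
gives so many short subsums of rotations that they meet differences of reflections
(`exists_sum_add_eq`). -/

namespace DihedralEGZ

open scoped Pointwise
-- Kemperman–Scherk and the number of short subsums
section Scherk

variable {α : Type*} [AddCommGroup α] [DecidableEq α]

/-- The Kemperman–Scherk theorem: if `0` lies in `A` and in `B` and is a sum `a + b` only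
trivially, then `|A + B| ≥ |A| + |B| - 1`. -/
theorem card_add_card_le_card_add {A B : Finset α} (hA : 0 ∈ A) (hB : 0 ∈ B)
    (h : ∀ a ∈ A, ∀ b ∈ B, a + b = 0 → a = 0 ∧ b = 0) :
    A.card + B.card ≤ (A + B).card + 1 := by
  induction hk : B.card using Nat.strong_induction_on generalizing A B with
  | _ k ih =>
  subst hk
  by_cases hB1 : ∃ b ∈ B, b ≠ 0
  · obtain ⟨b, hb, hb0⟩ := hB1
    -- Otherwise translation by `b` permutes `A`, and `0 ∈ A` becomes a nontrivial sum.
    have hex : ∃ a ∈ A, a + b ∉ A := by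
      by_contra! hcon
      have himg : A.image (· + b) = A :=
        Finset.eq_of_subset_of_card_le
          (Finset.image_subset_iff.2 hcon)
          (Finset.card_image_of_injective _ (add_left_injective b)).ge
      have h0 : (0 : α) ∈ A.image (· + b) := by rw [himg]; exact hA
      obtain ⟨a, ha, hab⟩ := Finset.mem_image.1 h0
      exact hb0 (h a ha b hb hab).2
    obtain ⟨a, ha, hab⟩ := hex
    -- Dyson's transform at `a`: it keeps the total cardinality, does not enlarge the sumset,
    -- preserves the hypothesis on zero sums, and removes `b` from `B`.
    set A' := A ∪ B.image (· + a) with hA'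
    set B' := B.filter (fun x => x + a ∈ A) with hB'
    have hlt : B'.card < B.card := by
      apply Finset.card_lt_card
      refine Finset.filter_ssubset.2 ⟨b, hb, ?_⟩
      rwa [add_comm]
    have hcard : A'.card + B'.card = A.card + B.card := by
      have h1 := Finset.card_union_add_card_inter A (B.image (· + a))
      have h2 : A ∩ B.image (· + a) = B'.image (· + a) := by
        ext x
        simp only [hB', Finset.mem_inter, Finset.mem_image, Finset.mem_filter]
        constructor
        · rintro ⟨hx, y, hy, rfl⟩
          exact ⟨y, ⟨hy, hx⟩, rfl⟩
        · rintro ⟨y, ⟨hy, hx⟩, rfl⟩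
          exact ⟨hx, y, hy, rfl⟩
      rw [h2, Finset.card_image_of_injective _ (add_left_injective a),
        Finset.card_image_of_injective _ (add_left_injective a)] at h1
      exact h1
    have hsub : A' + B' ⊆ A + B := by
      intro x hx
      obtain ⟨p, hp, q, hq, rfl⟩ := Finset.mem_add.1 hx
      rw [hB', Finset.mem_filter] at hq
      rw [hA', Finset.mem_union, Finset.mem_image] at hp
      rcases hp with hp | ⟨y, hy, rfl⟩
      · exact Finset.add_mem_add hp hq.1
      · rw [show y + a + q = (q + a) + y by abel]
        exact Finset.add_mem_add hq.2 hy
    have := ih B'.card hlt (A := A') (B := B') (Finset.mem_union_left _ hA)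
      (by simpa [hB'] using ⟨hB, ha⟩) (by
        intro p hp q hq hpq
        rw [hB', Finset.mem_filter] at hq
        rw [hA', Finset.mem_union, Finset.mem_image] at hp
        rcases hp with hp | ⟨y, hy, rfl⟩
        · exact h p hp q hq.1 hpq
        · have h1 := h (q + a) hq.2 y hy (by rw [← hpq]; abel)
          have h2 := h a ha q hq.1 (by rw [← h1.1]; abel)
          refine ⟨?_, h2.2⟩
          rw [h1.2, h2.1, add_zero]) rfl
    have := Finset.card_le_card hsub
    omega
  · push Not at hB1
    have : B = {0} := Finset.eq_singleton_iff_unique_mem.2 ⟨hB, hB1⟩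
    subst this
    simp

/-- The set of sums of at most `h` terms of `T`. -/
def boundedSums (h : ℕ) (T : Multiset α) : Finset α :=
  ((T.powerset.filter (fun W => W.card ≤ h)).map Multiset.sum).toFinset

theorem mem_boundedSums {h : ℕ} {T : Multiset α} {x : α} :
    x ∈ boundedSums h T ↔ ∃ W ≤ T, W.card ≤ h ∧ W.sum = x := by
  simp [boundedSums, and_assoc]

/-- Peel off one copy of each distinct term. The peeled set together with `0`, added to the sums of
at most `h` remaining terms, satisfies the Scherk hypothesis, because a nontrivial zero would be a
short zero-sum. Each layer thus adds at least its own size. -/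
theorem card_lt_card_boundedSums {h : ℕ} {T : Multiset α} (hc : ∀ e, T.count e ≤ h)
    (hz : ∀ V ≤ T, V ≠ 0 → V.card ≤ h → V.sum ≠ 0) :
    T.card < (boundedSums h T).card := by
  induction h generalizing T with
  | zero =>
    have : T = 0 := by
      ext e
      simpa using hc e
    subst this
    simp only [Multiset.card_zero]
    exact Finset.card_pos.2 ⟨0, mem_boundedSums.2 ⟨0, le_rfl, by simp, by simp⟩⟩
  | succ h ih =>
    have hT : T.toFinset.val ≤ T := by
      rw [Multiset.toFinset_val]; exact Multiset.dedup_le T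
    set T' := T - T.toFinset.val with hT'
    have hTT : T.toFinset.val + T' = T := add_tsub_cancel_of_le hT
    have hT'T : T' ≤ T := tsub_le_self
    have hcount : ∀ e, T'.count e ≤ h := by
      intro e
      rw [hT', Multiset.count_sub, Multiset.toFinset_val, Multiset.count_dedup]
      have := hc e
      split_ifs with he
      · omega
      · rw [Multiset.count_eq_zero_of_notMem he]; omega
    have hi := ih hcount (fun V hV hV0 hVc => hz V (hV.trans hT'T) hV0 (by omega))
    have hmem0 : (0 : α) ∈ boundedSums h T' := mem_boundedSums.2 ⟨0, by simp, by simp, by simp⟩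
    have h0T : (0 : α) ∉ T.toFinset := by
      intro h0
      exact hz {0} (Multiset.singleton_le.2 (Multiset.mem_toFinset.1 h0)) (by simp) (by simp)
        (by simp)
    have hadd : ∀ a ∈ T.toFinset, ∀ W ≤ T', a ::ₘ W ≤ T := by
      intro a ha W hW
      rw [← hTT, ← Multiset.singleton_add]
      exact add_le_add (Multiset.singleton_le.2 ha) hW
    have hsch := card_add_card_le_card_add (A := insert 0 T.toFinset) (B := boundedSums h T')
      (Finset.mem_insert_self _ _) hmem0 (by
        intro a ha b hb hab
        obtain ⟨W, hW, hWc, rfl⟩ := mem_boundedSums.1 hb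
        rcases Finset.mem_insert.1 ha with rfl | ha
        · exact ⟨rfl, by simpa using hab⟩
        · exact absurd (by simpa using hab) (hz (a ::ₘ W) (hadd a ha W hW) (by simp)
            (by simpa using hWc)))
    have hsub : insert 0 T.toFinset + boundedSums h T' ⊆ boundedSums (h + 1) T := by
      intro x hx
      obtain ⟨a, ha, b, hb, rfl⟩ := Finset.mem_add.1 hx
      obtain ⟨W, hW, hWc, rfl⟩ := mem_boundedSums.1 hb
      rcases Finset.mem_insert.1 ha with rfl | ha
      · exact mem_boundedSums.2 ⟨W, hW.trans hT'T, by omega, by simp⟩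
      · exact mem_boundedSums.2 ⟨a ::ₘ W, hadd a ha W hW, by simpa using hWc, by simp⟩
    have h1 := Finset.card_le_card hsub
    rw [Finset.card_insert_of_notMem h0T] at hsch
    have h2 : T.toFinset.card + T'.card = T.card := by
      conv_rhs => rw [← hTT]
      rw [Multiset.card_add, Finset.card_val]
    omega

/-- Adjoining a term to a zero-sum free sequence produces at least one new subsum. -/
theorem card_sums_le_of_zeroSumFree {T W : Multiset α}
    (hz : ∀ V ≤ W + T, V ≠ 0 → V.sum ≠ 0) :
    (boundedSums T.card T).card + W.card ≤ (boundedSums (W + T).card (W + T)).card := by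
  induction W using Multiset.induction_on with
  | empty => simp
  | cons x W ih =>
    have hle : W + T ≤ x ::ₘ W + T := by
      rw [Multiset.cons_add]; exact Multiset.le_cons_self _ _
    have hi := ih fun V hV => hz V (hV.trans hle)
    have hx : x ≠ 0 := by
      have := hz {x} (by simp) (by simp)
      simpa using this
    have hcons : ∀ V ≤ W + T, x ::ₘ V ≤ x ::ₘ W + T := fun V hV => by
      rw [Multiset.cons_add]; exact Multiset.cons_le_cons _ hV
    have hsch := card_add_card_le_card_add (A := {0, x}) (B := boundedSums (W + T).card (W + T))
      (by simp) (mem_boundedSums.2 ⟨0, by simp, by simp, by simp⟩) (by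
        intro a ha b hb hab
        obtain ⟨V, hV, hVc, rfl⟩ := mem_boundedSums.1 hb
        rcases Finset.mem_insert.1 ha with rfl | ha
        · exact ⟨rfl, by simpa using hab⟩
        · rw [Finset.mem_singleton] at ha
          subst ha
          exact absurd (by simpa using hab) (hz _ (hcons V hV) (by simp)))
    have hsub : {0, x} + boundedSums (W + T).card (W + T) ⊆
        boundedSums (x ::ₘ W + T).card (x ::ₘ W + T) := by
      intro y hy
      obtain ⟨a, ha, b, hb, rfl⟩ := Finset.mem_add.1 hy
      obtain ⟨V, hV, hVc, rfl⟩ := mem_boundedSums.1 hb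
      rcases Finset.mem_insert.1 ha with rfl | ha
      · exact mem_boundedSums.2
          ⟨V, hV.trans hle, Multiset.card_le_card (hV.trans hle), by simp⟩
      · rw [Finset.mem_singleton] at ha
        subst ha
        exact mem_boundedSums.2
          ⟨_, hcons V hV, Multiset.card_le_card (hcons V hV), by simp⟩
    have h1 := Finset.card_le_card hsub
    rw [Finset.card_pair hx.symm] at hsch
    rw [Multiset.card_cons]
    omega

/-- Two distinct terms already have the four subsums `0, x, y, x + y`, and each further term adds at
least one, which exceeds the order of the group. -/
theorem eq_of_mem_of_zeroSumFree [Fintype α] {T : Multiset α}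
    (hz : ∀ V ≤ T, V ≠ 0 → V.sum ≠ 0) (hT : Fintype.card α ≤ T.card + 1)
    {x y : α} (hx : x ∈ T) (hy : y ∈ T) : x = y := by
  by_contra hxy
  have hle : ({x, y} : Multiset α) ≤ T :=
    (Multiset.le_iff_subset (by simpa using hxy)).2 (by simp [Multiset.insert_eq_cons, hx, hy])
  have hTT : (T - {x, y}) + {x, y} = T := tsub_add_cancel_of_le hle
  have h1 := card_sums_le_of_zeroSumFree (T := {x, y}) (W := T - {x, y}) (by rwa [hTT])
  rw [hTT] at h1
  have hx0 : x ≠ 0 := by simpa using hz {x} (by simpa using hx) (by simp)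
  have hy0 : y ≠ 0 := by simpa using hz {y} (by simpa using hy) (by simp)
  have hxy0 : x + y ≠ 0 := by simpa using hz {x, y} hle (by simp)
  have h4 : ({0, x, y, x + y} : Finset α) ⊆ boundedSums 2 {x, y} := by
    intro z hz
    simp only [Finset.mem_insert, Finset.mem_singleton] at hz
    rcases hz with rfl | rfl | rfl | rfl
    · exact mem_boundedSums.2 ⟨0, by simp, by simp, by simp⟩
    · exact mem_boundedSums.2 ⟨{z}, by simp, by simp, by simp⟩
    · exact mem_boundedSums.2 ⟨{z}, by simp, by simp, by simp⟩
    · exact mem_boundedSums.2 ⟨{x, y}, le_rfl, by simp, by simp⟩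
  have h5 : ({0, x, y, x + y} : Finset α).card = 4 := by
    rw [Finset.card_insert_of_notMem, Finset.card_insert_of_notMem,
      Finset.card_insert_of_notMem, Finset.card_singleton]
    · simpa using hx0
    · simpa using ⟨hxy, hy0⟩
    · simpa using ⟨hx0.symm, hy0.symm, hxy0.symm⟩
  have h6 := Finset.card_le_card h4
  have h7 := Finset.card_le_univ (boundedSums T.card T)
  have h8 : T.card = (T - {x, y}).card + 2 := by
    conv_lhs => rw [← hTT]
    simp
  rw [Multiset.card_pair] at h1
  omega

end Scherk

/-! ### Inverse Erdős–Ginzburg–Ziv theorems for lengths `n` and `2 * n` -/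

section InverseEGZ

/-- No zero-sum subsequence has length in the window from `L - h` to `L`. Adjoining a zero-sum block
of length at most `h` cannot jump over this window, so growth below it continues until no short
block is left. -/
theorem exists_maximal_zeroSum {α : Type*} [AddCommGroup α] [DecidableEq α] {T V : Multiset α}
    {h L : ℕ} (hVT : V ≤ T) (hV0 : V.sum = 0) (hVc : V.card + h + 1 ≤ L)
    (hno : ∀ W ≤ T, W.sum = 0 → L ≤ W.card + h → L < W.card) :
    ∃ U, V ≤ U ∧ U ≤ T ∧ U.sum = 0 ∧ U.card + h + 1 ≤ L ∧
      ∀ W ≤ T - U, W ≠ 0 → W.card ≤ h → W.sum ≠ 0 := by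
  induction hk : L - V.card using Nat.strong_induction_on generalizing V with
  | _ k ih =>
  by_cases hex : ∃ W ≤ T - V, W ≠ 0 ∧ W.card ≤ h ∧ W.sum = 0
  · obtain ⟨W, hW, hW0, hWc, hWs⟩ := hex
    have hVW : V + W ≤ T := by
      rw [← add_tsub_cancel_of_le hVT]
      exact add_le_add_right hW _
    have hpos : 0 < W.card := Multiset.card_pos.2 hW0
    have hs : (V + W).sum = 0 := by simp [hV0, hWs]
    have hc : (V + W).card + h + 1 ≤ L := by
      by_contra hcon
      have := hno _ hVW hs (by omega)
      rw [Multiset.card_add] at this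
      omega
    rw [Multiset.card_add] at hc
    obtain ⟨U, h1, h2⟩ := ih (L - (V + W).card) (by rw [Multiset.card_add]; omega) hVW hs
      (by rw [Multiset.card_add]; omega) rfl
    exact ⟨U, (Multiset.le_add_right V W).trans h1, h2⟩
  · push Not at hex
    exact ⟨V, le_rfl, hVT, hV0, hVc, hex⟩

variable {n : ℕ}

theorem isUnit_of_mul_ne_zero [NeZero n] {g : ZMod n}
    (hg : ∀ j : ℕ, 0 < j → j < n → (j : ZMod n) * g ≠ 0) : IsUnit g := by
  have hinj : Function.Injective (fun x : ZMod n => x * g) := by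
    intro x y hxy
    by_contra hne
    have h0 : x - y ≠ 0 := sub_ne_zero.2 hne
    apply hg (x - y).val (Nat.pos_of_ne_zero fun h => h0 ((ZMod.val_eq_zero _).1 h))
      (ZMod.val_lt _)
    rw [ZMod.natCast_zmod_val, sub_mul]
    exact sub_eq_zero.2 hxy
  obtain ⟨b, hb⟩ := Finite.injective_iff_surjective.1 hinj 1
  exact IsUnit.of_mul_eq_one b (by rw [mul_comm]; exact hb)

/-- Translate a most frequent term to zero. -/
theorem exists_translate {A : Multiset (ZMod n)} {L : ℕ} (hL : n ∣ L) (hA : A ≠ 0)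
    (hno : ∀ W ≤ A, W.card = L → W.sum ≠ 0) :
    ∃ (u : ZMod n) (h : ℕ) (T : Multiset (ZMod n)),
      A = Multiset.replicate h u + T.map (· + u) ∧ 0 < h ∧ h + 1 ≤ L ∧
      (∀ e, T.count e ≤ h) ∧
      ∀ W ≤ T, W.sum = 0 → L ≤ W.card + h → L < W.card := by
  have hLz : (L : ZMod n) = 0 := (ZMod.natCast_eq_zero_iff _ _).2 hL
  obtain ⟨u, huA, hu⟩ := Finset.exists_max_image A.toFinset (fun x => A.count x)
    (by simpa [Finset.nonempty_iff_ne_empty] using hA)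
  have hpos : 0 < A.count u := Multiset.count_pos.2 (Multiset.mem_toFinset.1 huA)
  set T := (A.filter (· ≠ u)).map (· - u) with hT
  have hTu : T.map (· + u) = A.filter (· ≠ u) := by simp [hT, Multiset.map_map]
  have hAT : A = Multiset.replicate (A.count u) u + T.map (· + u) := by
    rw [hTu, ← Multiset.filter_eq', Multiset.filter_add_not]
  -- A zero-sum `W` in the window could be padded by copies of `u` to length exactly `L`;
  -- translating back adds `L • u = 0`.
  have hmain : ∀ W ≤ T, W.sum = 0 → L ≤ W.card + A.count u → L < W.card := by
    intro W hW hW0 hWc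
    by_contra hcon
    refine hno (Multiset.replicate (L - W.card) u + W.map (· + u)) ?_ ?_ ?_
    · conv_rhs => rw [hAT]
      exact add_le_add ((Multiset.replicate_le_replicate u).2 (by omega))
        (Multiset.map_le_map hW)
    · simp; omega
    · rw [Multiset.sum_add, Multiset.sum_map_add]
      simp only [Multiset.sum_replicate, Multiset.map_const', Multiset.map_id', hW0, zero_add]
      rw [← add_nsmul, Nat.sub_add_cancel (by omega), nsmul_eq_mul, hLz, zero_mul]
  refine ⟨u, A.count u, T, hAT, hpos, ?_, ?_, hmain⟩
  · by_contra hcon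
    have := hmain 0 (by simp) (by simp) (by simp; omega)
    simp at this
  · intro e
    have h1 : T.count e = (T.map (· + u)).count (e + u) :=
      (Multiset.count_map_eq_count' _ _ (add_left_injective u) _).symm
    have h2 : (A.filter (· ≠ u)).count (e + u) ≤ A.count (e + u) :=
      Multiset.count_le_of_le _ (Multiset.filter_le _ _)
    rw [h1, hTu]
    refine h2.trans ?_
    by_cases he : e + u ∈ A
    · exact hu _ (Multiset.mem_toFinset.2 he)
    · rw [Multiset.count_eq_zero_of_notMem he]; omega

/-- The inverse Erdős–Ginzburg–Ziv theorem for cyclic groups. -/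
theorem eq_replicate_of_forall_sum_ne_zero [NeZero n] (hn : 2 ≤ n) {A : Multiset (ZMod n)}
    (hA : A.card + 2 = 2 * n) (hno : ∀ W ≤ A, W.card = n → W.sum ≠ 0) :
    ∃ u v : ZMod n, IsUnit (v - u) ∧
      A = Multiset.replicate (n - 1) u + Multiset.replicate (n - 1) v := by
  have hA0 : A ≠ 0 := by rintro rfl; simp at hA; omega
  obtain ⟨u, h, T, hAT, hpos, hhn, hcount, hT⟩ := exists_translate dvd_rfl hA0 hno
  have hcard : h + T.card + 2 = 2 * n := by rw [← hA, hAT]; simp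
  have hfull : ∀ T' : Multiset (ZMod n), (∀ e, T'.count e ≤ h) →
      (∀ V ≤ T', V ≠ 0 → V.card ≤ h → V.sum ≠ 0) → T'.card + 1 ≤ n := by
    intro T' h1 h2
    have h3 := card_lt_card_boundedSums h1 h2
    have h4 := Finset.card_le_univ (boundedSums h T')
    rw [ZMod.card] at h4
    omega
  rcases Nat.lt_or_ge (h + 1) n with hlt | hge
  · exfalso
    have hex : ∃ V ≤ T, V ≠ 0 ∧ V.card ≤ h ∧ V.sum = 0 := by
      by_contra! hcon
      have := hfull T hcount hcon
      omega
    obtain ⟨V, hVT, hV0, hVc, hVs⟩ := hex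
    have hVpos : 0 < V.card := Multiset.card_pos.2 hV0
    obtain ⟨U, hVU, hUT, hUs, hUc, hU⟩ := exists_maximal_zeroSum (h := h) (L := n) hVT hVs
      (by by_contra hcon; have := hT V hVT hVs (by omega); omega) hT
    have hsub : T - U ≤ T := tsub_le_self
    have hc' : ∀ e, (T - U).count e ≤ h := fun e =>
      (Multiset.count_le_of_le e hsub).trans (hcount e)
    have hlt1 := card_lt_card_boundedSums hc' hU
    have hUTc : (T - U).card + U.card = T.card := by
      rw [← Multiset.card_add, tsub_add_cancel_of_le hUT]
    have hle := hfull _ hc' hU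
    -- The length of `T - U` is squeezed to `n - 1`, so its short sums cover the group. In
    -- particular its total is a short sum; the complement `Z` of that short part is a zero-sum of
    -- length at least `n - 1 - h`. The window excludes more than that, and then `Z + V` falls into
    -- the window.
    have huniv : boundedSums h (T - U) = Finset.univ := by
      apply Finset.eq_univ_of_card
      have h4 := Finset.card_le_univ (boundedSums h (T - U))
      rw [ZMod.card] at h4 ⊢
      omega
    have hσ : (T - U).sum ∈ boundedSums h (T - U) := by rw [huniv]; simp
    obtain ⟨W, hW, hWc, hWs⟩ := mem_boundedSums.1 hσ
    have hZW : (T - U - W) + W = T - U := tsub_add_cancel_of_le hW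
    have hZs : (T - U - W).sum = 0 := by
      have := congrArg Multiset.sum hZW
      rw [Multiset.sum_add, hWs] at this
      simpa using this
    have hZc : (T - U - W).card + W.card = (T - U).card := by
      rw [← Multiset.card_add, hZW]
    have h1 := hT _ (tsub_le_self.trans hsub) hZs
    have h2 := hT (T - U - W + V) (by
      conv_rhs => rw [← tsub_add_cancel_of_le hUT]
      exact add_le_add tsub_le_self hVU) (by rw [Multiset.sum_add, hZs, hVs, add_zero])
    rw [Multiset.card_add] at h2
    omega
  · have hh : h = n - 1 := by omega
    have hTc : T.card = n - 1 := by omega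
    have hz : ∀ V ≤ T, V ≠ 0 → V.sum ≠ 0 := by
      intro V hV hV0 hVs
      have hpos := Multiset.card_pos.2 hV0
      have := hT V hV hVs (by omega)
      have := Multiset.card_le_card hV
      omega
    obtain ⟨g, hg⟩ : ∃ g, g ∈ T := Multiset.card_pos_iff_exists_mem.1 (by omega)
    have hTg : T = Multiset.replicate (n - 1) g :=
      Multiset.eq_replicate.2 ⟨hTc, fun b hb =>
        eq_of_mem_of_zeroSumFree hz (by rw [ZMod.card]; omega) hb hg⟩
    refine ⟨u, g + u, ?_, ?_⟩
    · rw [add_sub_cancel_right]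
      refine isUnit_of_mul_ne_zero fun j hj hjn => ?_
      have := hz (Multiset.replicate j g)
        (by rw [hTg]; exact (Multiset.replicate_le_replicate g).2 (by omega))
        (by rw [← Multiset.card_pos]; simpa using hj)
      simpa using this
    · rw [hAT, hTg, hh]; simp

theorem exists_zeroSum_of_card {A : Multiset (ZMod n)} (hA : 2 * n ≤ A.card + 1) :
    ∃ W ≤ A, W.card = n ∧ W.sum = 0 :=
  ZMod.erdos_ginzburg_ziv_multiset A (by omega)

theorem exists_zeroSum_two_mul_of_card {A : Multiset (ZMod n)} (hA : 3 * n ≤ A.card + 1) :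
    ∃ W ≤ A, W.card = 2 * n ∧ W.sum = 0 := by
  obtain ⟨V, hVA, hVc, hVs⟩ := exists_zeroSum_of_card (A := A) (by omega)
  have hc : (A - V).card + V.card = A.card := by
    rw [← Multiset.card_add, tsub_add_cancel_of_le hVA]
  obtain ⟨W, hWA, hWc, hWs⟩ := exists_zeroSum_of_card (A := A - V) (by omega)
  refine ⟨V + W, ?_, by rw [Multiset.card_add]; omega, by simp [hVs, hWs]⟩
  conv_rhs => rw [← add_tsub_cancel_of_le hVA]
  exact add_le_add_right hWA _

/-- Removing any zero-sum block of length `n` leaves an extremal sequence for length `n`, hence two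
values `n - 1` times each. Comparing the results for different blocks determines the block itself.
-/
theorem eq_replicate_of_forall_sum_ne_zero_two_mul [NeZero n] (hn : 3 ≤ n) {A : Multiset (ZMod n)}
    (hA : A.card + 2 = 3 * n) (hno : ∀ W ≤ A, W.card = 2 * n → W.sum ≠ 0) :
    ∃ u v : ZMod n, IsUnit (v - u) ∧
      A = Multiset.replicate (2 * n - 1) u + Multiset.replicate (n - 1) v := by
  have hstep : ∀ V ≤ A, V.card = n → V.sum = 0 → ∃ u v : ZMod n, IsUnit (v - u) ∧
      A - V = Multiset.replicate (n - 1) u + Multiset.replicate (n - 1) v := by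
    intro V hVA hVc hVs
    have hc : (A - V).card + V.card = A.card := by
      rw [← Multiset.card_add, tsub_add_cancel_of_le hVA]
    refine eq_replicate_of_forall_sum_ne_zero (by omega) (by omega) fun W hW hWc hWs => ?_
    refine hno (V + W) ?_ (by rw [Multiset.card_add]; omega) (by simp [hVs, hWs])
    conv_rhs => rw [← add_tsub_cancel_of_le hVA]
    exact add_le_add_right hW _
  have hsum : ∀ x : ZMod n, (Multiset.replicate n x).sum = 0 := by simp
  have hn1 : ∀ x y : ZMod n, (x ::ₘ Multiset.replicate (n - 1) y).sum = 0 → x = y := by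
    intro x y hxy
    rw [Multiset.sum_cons, Multiset.sum_replicate] at hxy
    have hy : y + (n - 1) • y = 0 := by
      rw [← succ_nsmul', Nat.sub_add_cancel (by omega)]
      simp
    exact add_right_cancel (hxy.trans hy.symm)
  have hne : ∀ u v : ZMod n, IsUnit (v - u) → u ≠ v := by
    rintro u v huv rfl
    have : Fact (1 < n) := ⟨by omega⟩
    simp at huv
  have hkey : ∀ u v : ZMod n, ∀ V : Multiset (ZMod n), IsUnit (v - u) → V.card = n → V.sum = 0 →
      A = V + (Multiset.replicate (n - 1) u + Multiset.replicate (n - 1) v) → u ∈ V →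
      A = Multiset.replicate (2 * n - 1) u + Multiset.replicate (n - 1) v := by
    intro u v V huv hVc hVs hAV huV
    have huv' := hne u v huv
    obtain ⟨V', rfl⟩ := Multiset.exists_cons_of_mem huV
    have hV'c : V'.card = n - 1 := by simp at hVc; omega
    have hrep : Multiset.replicate n u = u ::ₘ Multiset.replicate (n - 1) u := by
      rw [← Multiset.replicate_succ]; congr 1; omega
    have hA1 : A = Multiset.replicate n u + (V' + Multiset.replicate (n - 1) v) := by
      rw [hAV, hrep, Multiset.cons_add, Multiset.cons_add]
      congr 1; abel
    -- Exchange `V` for `n` copies of `u`: the new complement forces the rest `V'` of `V` to be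
    -- constant, and the zero sum of `V` makes that constant equal to `u`.
    obtain ⟨x, y, hxy, hAxy⟩ := hstep (Multiset.replicate n u)
      (by rw [hA1]; exact Multiset.le_add_right _ _) (by simp) (hsum u)
    rw [hA1, add_tsub_cancel_left] at hAxy
    have hxy' := hne x y hxy
    have hV'x : ∃ x', V' = Multiset.replicate (n - 1) x' := by
      have hv := congrArg (Multiset.count v) hAxy
      simp only [Multiset.count_add, Multiset.count_replicate] at hv
      by_cases hxv : x = v
      · subst hxv
        exact ⟨y, by rw [add_comm] at hAxy; exact add_left_cancel hAxy⟩
      · by_cases hyv : y = v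
        · subst hyv
          exact ⟨x, add_right_cancel hAxy⟩
        · simp [hxv, hyv] at hv; omega
    obtain ⟨x', rfl⟩ := hV'x
    rw [← hn1 u x' hVs] at hA1
    rw [hA1, ← add_assoc, ← Multiset.replicate_add]
    congr 2; omega
  obtain ⟨V, hVA, hVc, hVs⟩ := exists_zeroSum_of_card (A := A) (by omega)
  obtain ⟨u, v, huv, hAV⟩ := hstep V hVA hVc hVs
  have hAV' : A = V + (Multiset.replicate (n - 1) u + Multiset.replicate (n - 1) v) := by
    rw [← hAV, add_tsub_cancel_of_le hVA]
  have huv' := hne u v huv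
  by_cases hu : u ∈ V
  · exact ⟨u, v, huv, hkey u v V huv hVc hVs hAV' hu⟩
  by_cases hv : v ∈ V
  · have hvu : IsUnit (u - v) := by rw [← neg_sub]; exact huv.neg
    exact ⟨v, u, hvu, hkey v u V hvu hVc hVs (by rw [hAV']; congr 1; abel) hv⟩
  exfalso
  obtain ⟨g, hg⟩ : ∃ g, g ∈ V := Multiset.card_pos_iff_exists_mem.1 (by omega)
  obtain ⟨V', rfl⟩ := Multiset.exists_cons_of_mem hg
  set R := Multiset.replicate (n - 1) u + Multiset.replicate (n - 1) v with hR
  have hRc : R.card = 2 * (n - 1) := by simp [hR]; omega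
  -- If `V` contains neither `u` nor `v`, a second block avoiding `V'` leaves `u`, `v` and a term of
  -- `V'` outside it: three distinct values where only two are allowed.
  obtain ⟨V₂, hV₂, hV₂c, hV₂s⟩ := exists_zeroSum_of_card (A := g ::ₘ R) (by simp [hRc]; omega)
  have hAg : A = V' + (g ::ₘ R) := by rw [hAV']; simp
  have hV₂A : V₂ ≤ A := by rw [hAg]; exact hV₂.trans (Multiset.le_add_left _ _)
  obtain ⟨x, y, hxy, hAxy⟩ := hstep V₂ hV₂A hV₂c hV₂s
  have hxy' := hne x y hxy
  have hu0 : Multiset.count u V' = 0 := Multiset.count_eq_zero_of_notMem (fun h => hu (by simp [h]))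
  have hv0 : Multiset.count v V' = 0 := Multiset.count_eq_zero_of_notMem (fun h => hv (by simp [h]))
  have hgu : u ≠ g := fun h => hu (by simp [h])
  have hgv : v ≠ g := fun h => hv (by simp [h])
  have hmiss : ∀ w, A.count w = n - 1 → w ∈ A - V₂ := by
    intro w hw
    by_contra hcon
    have h0 := Multiset.count_eq_zero_of_notMem hcon
    have h1 := Multiset.count_le_of_le w hV₂A
    rw [Multiset.count_sub] at h0
    have h2 : Multiset.replicate (n - 1) w ≤ V₂ := Multiset.le_count_iff_replicate_le.1 (by omega)
    obtain ⟨Z, hZ⟩ := Multiset.le_iff_exists_add.1 h2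
    have h3 := congrArg Multiset.card hZ
    rw [Multiset.card_add, Multiset.card_replicate] at h3
    obtain ⟨z, rfl⟩ := Multiset.card_eq_one.1 (show Z.card = 1 by omega)
    have h4 := hn1 z w (by rw [← hV₂s, hZ, add_comm, Multiset.singleton_add])
    subst h4
    have h5 := congrArg (Multiset.count z) hZ
    simp at h5
    omega
  have hx : ∀ w, w ∈ A - V₂ → w = x ∨ w = y := by
    intro w hw
    rw [hAxy, Multiset.mem_add] at hw
    exact hw.imp Multiset.eq_of_mem_replicate Multiset.eq_of_mem_replicate
  have hu1 := hx u (hmiss u (by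
    rw [hAg, hR]; simp [Multiset.count_replicate, hu0, hgu, huv'.symm]))
  have hv1 := hx v (hmiss v (by
    rw [hAg, hR]; simp [Multiset.count_replicate, hv0, hgv, huv']))
  obtain ⟨z, hz⟩ : ∃ z, z ∈ V' := Multiset.card_pos_iff_exists_mem.1 (by simp at hVc; omega)
  have hz1 := hx z (by
    rw [hAg]
    refine Multiset.mem_of_le (le_tsub_of_add_le_right ?_) hz
    exact add_le_add_right hV₂ V')
  have hzu : u ≠ z := fun h => hu (by simp [h, hz])
  have hzv : v ≠ z := fun h => hv (by simp [h, hz])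
  rcases hu1 with h1 | h1 <;> rcases hv1 with h2 | h2 <;> rcases hz1 with h3 | h3 <;>
    first
    | exact huv' (h1.trans h2.symm)
    | exact hzu (h1.trans h3.symm)
    | exact hzv (h2.trans h3.symm)

end InverseEGZ

/-! ### Signed zero-sums, pairs and quadruples -/

section Signed

variable {n : ℕ}

/-- The terms of `A` can be given signs, and half of the terms of `B` a plus sign and the other
half a minus sign, so that the total is zero. -/
def SignedZeroSum (A B : Multiset (ZMod n)) : Prop :=
  ∃ A₁ A₂ B₁ B₂ : Multiset (ZMod n), A₁ + A₂ = A ∧ B₁ + B₂ = B ∧ B₁.card = B₂.card ∧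
    A₁.sum + B₁.sum = A₂.sum + B₂.sum

theorem SignedZeroSum.add {A B A' B' : Multiset (ZMod n)} (h : SignedZeroSum A B)
    (h' : SignedZeroSum A' B') : SignedZeroSum (A + A') (B + B') := by
  obtain ⟨A₁, A₂, B₁, B₂, rfl, rfl, hc, hs⟩ := h
  obtain ⟨A₁', A₂', B₁', B₂', rfl, rfl, hc', hs'⟩ := h'
  refine ⟨A₁ + A₁', A₂ + A₂', B₁ + B₁', B₂ + B₂', by abel, by abel, by simp [hc, hc'], ?_⟩
  simp only [Multiset.sum_add]
  calc _ = (A₁.sum + B₁.sum) + (A₁'.sum + B₁'.sum) := by abel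
    _ = _ := by rw [hs, hs']; abel

theorem signedZeroSum_zero : SignedZeroSum (0 : Multiset (ZMod n)) 0 :=
  ⟨0, 0, 0, 0, by simp⟩

theorem signedZeroSum_double (Q : Multiset (ZMod n)) : SignedZeroSum 0 (Q + Q) :=
  ⟨0, 0, Q, Q, by simp⟩

theorem signedZeroSum_pair {x y : ZMod n} (h : x = y ∨ x = -y) : SignedZeroSum {x, y} 0 := by
  rcases h with rfl | rfl
  · exact ⟨{x}, {x}, 0, 0, by simp [Multiset.insert_eq_cons]⟩
  · exact ⟨{-y, y}, 0, 0, 0, by simp⟩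

theorem signedZeroSum_quad {a b c d : ZMod n} (h : a + b = c + d) :
    SignedZeroSum 0 {a, b, c, d} :=
  ⟨0, 0, {a, b}, {c, d}, by simp, rfl, by simp, by simpa using h⟩

theorem signedZeroSum_mixed {x₁ x₂ y₁ y₂ : ZMod n} (h : x₁ + y₁ = x₂ + y₂) :
    SignedZeroSum {x₁, x₂} {y₁, y₂} :=
  ⟨{x₁}, {x₂}, {y₁}, {y₂}, by simp [Multiset.insert_eq_cons, h]⟩

/-- `A` contains `i` disjoint pairs of terms that agree up to sign. -/
def HasPairs : ℕ → Multiset (ZMod n) → Prop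
  | 0, _ => True
  | i + 1, A => ∃ (x y : ZMod n) (R : Multiset (ZMod n)), A = x ::ₘ y ::ₘ R ∧ (x = y ∨ x = -y) ∧
      HasPairs i R

theorem HasPairs.add {i : ℕ} {A : Multiset (ZMod n)} (h : HasPairs i A) (B : Multiset (ZMod n)) :
    HasPairs i (A + B) := by
  induction i generalizing A with
  | zero => trivial
  | succ i ih =>
    obtain ⟨x, y, R, rfl, hxy, hR⟩ := h
    exact ⟨x, y, R + B, by simp, hxy, ih hR⟩

/-- Deleting one term destroys at most one pair. -/
theorem HasPairs.of_cons {i : ℕ} {z : ZMod n} {A : Multiset (ZMod n)}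
    (h : HasPairs (i + 1) (z ::ₘ A)) : HasPairs i A := by
  induction i generalizing A with
  | zero => trivial
  | succ i ih =>
    obtain ⟨x, y, R, hA, hxy, hR⟩ := h
    have hmem : z ∈ x ::ₘ y ::ₘ R := by rw [← hA]; simp
    rw [Multiset.mem_cons, Multiset.mem_cons] at hmem
    rcases hmem with rfl | rfl | hz
    · rw [(Multiset.cons_inj_right _).1 hA, ← Multiset.singleton_add, add_comm {_}]
      exact hR.add _
    · rw [Multiset.cons_swap, Multiset.cons_inj_right] at hA
      rw [hA, ← Multiset.singleton_add, add_comm {_}]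
      exact hR.add _
    · obtain ⟨R', rfl⟩ := Multiset.exists_cons_of_mem hz
      rw [Multiset.cons_swap y, Multiset.cons_swap x, Multiset.cons_inj_right] at hA
      exact ⟨x, y, R', hA, hxy, ih hR⟩

theorem HasPairs.of_succ {i : ℕ} {A : Multiset (ZMod n)} (h : HasPairs (i + 1) A) :
    HasPairs i A := by
  apply HasPairs.of_cons (z := 0)
  rw [← Multiset.singleton_add, add_comm {_}]
  exact h.add _

theorem HasPairs.anti {i j : ℕ} (hij : i ≤ j) {A : Multiset (ZMod n)} (h : HasPairs j A) :
    HasPairs i A := by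
  induction hij with
  | refl => exact h
  | step _ ih => exact ih h.of_succ

theorem HasPairs.exists_signedZeroSum {i : ℕ} {A : Multiset (ZMod n)} (h : HasPairs i A) :
    ∃ P ≤ A, P.card = 2 * i ∧ SignedZeroSum P 0 := by
  induction i generalizing A with
  | zero => exact ⟨0, by simp, by simp, signedZeroSum_zero⟩
  | succ i ih =>
    obtain ⟨x, y, R, rfl, hxy, hR⟩ := h
    obtain ⟨P, hP, hPc, hPs⟩ := ih hR
    refine ⟨{x, y} + P, ?_, by simp; omega, by simpa using (signedZeroSum_pair hxy).add hPs⟩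
    rw [show x ::ₘ y ::ₘ R = {x, y} + R by simp [Multiset.insert_eq_cons]]
    exact add_le_add_right hP _

theorem exists_cons_cons_of_not_nodup {α β : Type*} (f : α → β) {A : Multiset α}
    (h : ¬ (A.map f).Nodup) : ∃ x y R, A = x ::ₘ y ::ₘ R ∧ f x = f y := by
  induction A using Multiset.induction_on with
  | empty => simp at h
  | cons a A ih =>
    rw [Multiset.map_cons, Multiset.nodup_cons, not_and_or, not_not] at h
    rcases h with h | h
    · obtain ⟨b, hb, hab⟩ := Multiset.mem_map.1 h
      obtain ⟨R, rfl⟩ := Multiset.exists_cons_of_mem hb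
      exact ⟨a, b, R, rfl, hab.symm⟩
    · obtain ⟨x, y, R, rfl, hxy⟩ := ih h
      exact ⟨x, y, a ::ₘ R, by rw [Multiset.cons_swap a, Multiset.cons_swap a], hxy⟩

/-- The class of `x` up to sign. -/
def signClass (x : ZMod n) : ℕ := x.valMinAbs.natAbs

theorem signClass_eq_iff {x y : ZMod n} : signClass x = signClass y ↔ x = y ∨ x = -y :=
  ZMod.natAbs_valMinAbs_eq_natAbs_valMinAbs

theorem card_le_of_nodup_signClass [NeZero n] {A : Multiset (ZMod n)}
    (h : (A.map signClass).Nodup) : A.card ≤ n / 2 + 1 := by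
  have h1 : (⟨A.map signClass, h⟩ : Finset ℕ) ⊆ Finset.range (n / 2 + 1) := by
    intro c hc
    obtain ⟨x, -, rfl⟩ := Multiset.mem_map.1 (show c ∈ A.map signClass from hc)
    exact Finset.mem_range.2 (Nat.lt_succ_of_le x.natAbs_valMinAbs_le)
  simpa using Finset.card_le_card h1

theorem exists_mem_signClass [NeZero n] {A : Multiset (ZMod n)}
    (h : (A.map signClass).Nodup) (hc : n / 2 + 1 ≤ A.card) (x : ZMod n) :
    ∃ z ∈ A, x = z ∨ x = -z := by
  have h1 : (⟨A.map signClass, h⟩ : Finset ℕ) = Finset.range (n / 2 + 1) := by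
    apply Finset.eq_of_subset_of_card_le
    · intro c hc
      obtain ⟨x, -, rfl⟩ := Multiset.mem_map.1 (show c ∈ A.map signClass from hc)
      exact Finset.mem_range.2 (Nat.lt_succ_of_le x.natAbs_valMinAbs_le)
    · simpa using hc
  have h2 : signClass x ∈ (⟨A.map signClass, h⟩ : Finset ℕ) := by
    rw [h1]
    exact Finset.mem_range.2 (Nat.lt_succ_of_le x.natAbs_valMinAbs_le)
  obtain ⟨z, hz, hzx⟩ := Multiset.mem_map.1 (show signClass x ∈ A.map signClass from h2)
  exact ⟨z, hz, signClass_eq_iff.1 hzx.symm⟩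

theorem hasPairs_of_card [NeZero n] {i : ℕ} {A : Multiset (ZMod n)}
    (h : 2 * i + n / 2 ≤ A.card) : HasPairs i A := by
  induction i generalizing A with
  | zero => trivial
  | succ i ih =>
    have : ¬ (A.map signClass).Nodup := fun hnd => by
      have := card_le_of_nodup_signClass hnd
      omega
    obtain ⟨x, y, R, rfl, hxy⟩ := exists_cons_cons_of_not_nodup _ this
    exact ⟨x, y, R, rfl, signClass_eq_iff.1 hxy, ih (by simp at h; omega)⟩

theorem exists_pairs_add (A : Multiset (ZMod n)) :
    ∃ (i : ℕ) (P C : Multiset (ZMod n)), A = P + C ∧ P.card = 2 * i ∧ HasPairs i P ∧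
      (C.map signClass).Nodup := by
  induction hk : A.card using Nat.strong_induction_on generalizing A with
  | _ k ih =>
  by_cases hnd : (A.map signClass).Nodup
  · exact ⟨0, 0, A, by simp, by simp, trivial, hnd⟩
  · obtain ⟨x, y, R, rfl, hxy⟩ := exists_cons_cons_of_not_nodup _ hnd
    obtain ⟨i, P, C, rfl, hPc, hP, hC⟩ := ih R.card (by rw [← hk]; simp) R rfl
    exact ⟨i + 1, x ::ₘ y ::ₘ P, C, by simp, by simp; omega,
      ⟨x, y, P, rfl, signClass_eq_iff.1 hxy, hP⟩, hC⟩

theorem exists_double_add {α : Type*} (B : Multiset α) :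
    ∃ Q D : Multiset α, B = Q + Q + D ∧ D.Nodup := by
  induction hk : B.card using Nat.strong_induction_on generalizing B with
  | _ k ih =>
  by_cases hnd : (B.map id).Nodup
  · exact ⟨0, B, by simp, by simpa using hnd⟩
  · obtain ⟨x, y, R, rfl, hxy⟩ := exists_cons_cons_of_not_nodup _ hnd
    obtain ⟨Q, D, rfl, hD⟩ := ih R.card (by rw [← hk]; simp) R rfl
    simp only [id] at hxy
    subst hxy
    exact ⟨x ::ₘ Q, D, by simp, hD⟩

/-- The sequence with rotations `A` and reflections `B` has a signed zero-sum subsequence of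
length `L` that involves a reflection. -/
def HasSigned (A B : Multiset (ZMod n)) (L : ℕ) : Prop :=
  ∃ A₀ ≤ A, ∃ B₀ ≤ B, SignedZeroSum A₀ B₀ ∧ B₀ ≠ 0 ∧ A₀.card + B₀.card = L

theorem exists_le_card_eq {α : Type*} {Q : Multiset α} {j : ℕ} (h : j ≤ Q.card) :
    ∃ Q' ≤ Q, Q'.card = j := by
  obtain ⟨Q', hQ'⟩ := (Multiset.card_pos_iff_exists_mem (s := Multiset.powersetCard j Q)).1
    (by rw [Multiset.card_powersetCard]; exact Nat.choose_pos h)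
  rw [Multiset.mem_powersetCard] at hQ'
  exact ⟨Q', hQ'⟩

/-- Complete a signed zero-sum sequence to the length `L` by pairs that contribute zero. -/
theorem SignedZeroSum.hasSigned {A₀ B₀ P Q A B : Multiset (ZMod n)} {r s L : ℕ}
    (h : SignedZeroSum A₀ B₀) (hB₀ : B₀ ≠ 0) (hP : HasPairs r P) (hA : A₀ + P ≤ A)
    (hB : B₀ + (Q + Q) ≤ B) (hs : s ≤ r + Q.card) (hL : A₀.card + B₀.card + 2 * s = L) :
    HasSigned A B L := by
  obtain ⟨i, j, hi, hj, rfl⟩ : ∃ i j, i ≤ r ∧ j ≤ Q.card ∧ i + j = s :=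
    ⟨min s r, s - min s r, by omega, by omega, by omega⟩
  obtain ⟨P', hP', hP'c, hP's⟩ := (hP.anti hi).exists_signedZeroSum
  obtain ⟨Q', hQ', hQ'c⟩ := exists_le_card_eq hj
  refine ⟨A₀ + P', (add_le_add_right hP' _).trans hA, B₀ + (Q' + Q'),
    (add_le_add_right (add_le_add hQ' hQ') _).trans hB, ?_, ?_, ?_⟩
  · have := (h.add hP's).add (signedZeroSum_double Q')
    simpa using this
  · intro h0
    exact hB₀ (by simpa using (add_eq_zero.1 h0).1)
  · simp only [Multiset.card_add]
    omega

/-- There are more than `2 * n` ordered pairs of distinct terms, so some sum is attained by more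
than the two orderings of one pair; distinctness makes the second pair disjoint from the first. -/
theorem exists_quad [NeZero n] {D : Multiset (ZMod n)} (hD : D.Nodup) (h : n + 4 ≤ 2 * D.card) :
    ∃ Q R, D = Q + R ∧ Q.card = 4 ∧ SignedZeroSum 0 Q := by
  set F : Finset (ZMod n) := ⟨D, hD⟩ with hF
  have hFc : F.card = D.card := rfl
  obtain ⟨σ, -, hσ⟩ := Finset.exists_lt_card_fiber_of_mul_lt_card_of_maps_to
    (s := F.offDiag) (t := Finset.univ) (f := fun p => p.1 + p.2) (n := 2)
    (fun _ _ => Finset.mem_univ _) (by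
      rw [Finset.offDiag_card, Finset.card_univ, ZMod.card, hFc]
      obtain ⟨d, hd⟩ : ∃ d, D.card = d + 2 := ⟨D.card - 2, by omega⟩
      rw [hd] at h ⊢
      have : (d + 2) * (d + 2) - (d + 2) = (d + 2) * (d + 1) := by
        rw [← Nat.mul_sub_one]; rfl
      rw [this]
      nlinarith [Nat.le_mul_self d])
  obtain ⟨p, hp⟩ := Finset.card_pos.1 (lt_of_le_of_lt (Nat.zero_le 2) hσ)
  obtain ⟨x, y⟩ := p
  obtain ⟨q, hq, hq'⟩ := Finset.exists_mem_notMem_of_card_lt_card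
    (s := {(x, y), (y, x)}) (lt_of_le_of_lt Finset.card_le_two hσ)
  obtain ⟨z, w⟩ := q
  simp only [Finset.mem_filter, Finset.mem_offDiag] at hp hq
  obtain ⟨⟨hx, hy, hxy⟩, hs⟩ := hp
  obtain ⟨⟨hz, hw, hzw⟩, hs'⟩ := hq
  have hsum : x + y = z + w := hs.trans hs'.symm
  have hxz : x ≠ z := by
    rintro rfl
    exact hq' (by simp [add_left_cancel hsum])
  have hyw : y ≠ w := by
    rintro rfl
    exact hxz (add_right_cancel hsum)
  have hyz : y ≠ z := by
    rintro rfl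
    rw [add_comm] at hsum
    exact hq' (by simp [add_left_cancel hsum])
  have hxw : x ≠ w := by
    rintro rfl
    rw [add_comm] at hsum
    exact hyz (add_right_cancel hsum)
  have hle : ({x, y, z, w} : Multiset (ZMod n)) ≤ D := by
    refine (Multiset.le_iff_subset (by simp [hxy, hxz, hxw, hyz, hyw, hzw])).2 ?_
    intro a ha
    simp only [Multiset.insert_eq_cons, Multiset.mem_cons, Multiset.mem_singleton] at ha
    rcases ha with rfl | rfl | rfl | rfl <;> assumption
  exact ⟨{x, y, z, w}, D - {x, y, z, w}, (add_tsub_cancel_of_le hle).symm, by simp,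
    signedZeroSum_quad hsum⟩

theorem exists_quads [NeZero n] {D : Multiset (ZMod n)} (hD : D.Nodup) {j : ℕ}
    (h : 8 * j + n ≤ 2 * D.card + 4) :
    ∃ Q R, D = Q + R ∧ Q.card = 4 * j ∧ SignedZeroSum 0 Q := by
  induction j generalizing D with
  | zero => exact ⟨0, D, by simp, by simp, signedZeroSum_zero⟩
  | succ j ih =>
    obtain ⟨Q, R, rfl, hQc, hQ⟩ := exists_quad hD (by omega)
    rw [Multiset.card_add] at h
    obtain ⟨Q', R', rfl, hQ'c, hQ'⟩ := ih (Multiset.nodup_add.1 hD).2.1 (by omega)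
    exact ⟨Q + Q', R', by rw [add_assoc], by rw [Multiset.card_add]; omega,
      by simpa using hQ.add hQ'⟩

theorem exists_list_prod {n : ℕ} (B₁ B₂ : List (ZMod n)) (h : B₁.length = B₂.length) :
    ∃ l : List (DihedralGroup n),
      (l : Multiset (DihedralGroup n)) =
        (B₁ : Multiset (ZMod n)).map DihedralGroup.sr + (B₂ : Multiset (ZMod n)).map DihedralGroup.sr ∧
      l.prod = DihedralGroup.r (B₁.sum - B₂.sum) := by
  induction B₁ generalizing B₂ with
  | nil =>
    obtain rfl : B₂ = [] := by simpa using h.symm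
    exact ⟨[], by simp, by simp⟩
  | cons b B₁ ih =>
    cases B₂ with
    | nil => simp at h
    | cons c B₂ =>
      obtain ⟨l, hl, hp⟩ := ih B₂ (by simpa using h)
      refine ⟨DihedralGroup.sr c :: DihedralGroup.sr b :: l, ?_, ?_⟩
      · rw [← Multiset.cons_coe, ← Multiset.cons_coe, hl, ← Multiset.cons_coe b,
          ← Multiset.cons_coe c, Multiset.map_cons, Multiset.map_cons, Multiset.add_cons,
          Multiset.cons_add]
      · rw [List.prod_cons, List.prod_cons, hp, DihedralGroup.sr_mul_r, DihedralGroup.sr_mul_sr]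
        simp only [List.sum_cons]
        congr 1; abel

theorem prod_map_r {n : ℕ} (l : List (ZMod n)) :
    (l.map DihedralGroup.r).prod = DihedralGroup.r l.sum := by
  induction l with
  | nil => simp
  | cons a l ih => rw [List.map_cons, List.prod_cons, ih, DihedralGroup.r_mul_r, List.sum_cons]

/-- The rotations to be negated go between the first two reflections, the others after them; the
remaining reflections alternate in sign. Hence `B` must be nonempty. -/
theorem SignedZeroSum.isProductOne {A B : Multiset (ZMod n)} (h : SignedZeroSum A B)
    (hB : B ≠ 0) : IsProductOne (A.map DihedralGroup.r + B.map DihedralGroup.sr) := by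
  obtain ⟨A₁, A₂, B₁, B₂, rfl, rfl, hc, hs⟩ := h
  induction A₁ using Quotient.inductionOn with | _ A₁
  induction A₂ using Quotient.inductionOn with | _ A₂
  induction B₁ using Quotient.inductionOn with | _ B₁
  induction B₂ using Quotient.inductionOn with | _ B₂
  simp only [Multiset.quot_mk_to_coe] at *
  cases B₁ with
  | nil =>
    cases B₂ with
    | nil => simp at hB
    | cons => simp at hc
  | cons b B₁ =>
    cases B₂ with
    | nil => simp at hc
    | cons c B₂ =>
      obtain ⟨l, hl, hp⟩ := exists_list_prod B₁ B₂ (by simpa using hc)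
      refine ⟨DihedralGroup.sr c :: (A₂.map DihedralGroup.r ++
        DihedralGroup.sr b :: (A₁.map DihedralGroup.r ++ l)), ?_, ?_⟩
      · simp only [← Multiset.cons_coe, ← Multiset.coe_add, hl, ← Multiset.map_coe,
          Multiset.map_add, Multiset.map_cons]
        simp only [← Multiset.singleton_add]
        abel
      · simp only [List.prod_cons, List.prod_append, hp, prod_map_r, DihedralGroup.r_mul_r,
          DihedralGroup.sr_mul_r, DihedralGroup.r_mul_sr, DihedralGroup.sr_mul_sr]
        rw [← DihedralGroup.r_zero]
        congr 1
        simp only [Multiset.sum_coe, List.sum_cons] at hs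
        linear_combination hs

theorem HasSigned.hasProductOneSubseq {A B : Multiset (ZMod n)} {L : ℕ} (h : HasSigned A B L) :
    HasProductOneSubseq (A.map DihedralGroup.r + B.map DihedralGroup.sr) L := by
  obtain ⟨A₀, hA, B₀, hB, hs, hB0, hL⟩ := h
  exact ⟨_, add_le_add (Multiset.map_le_map hA) (Multiset.map_le_map hB), by simpa using hL,
    hs.isProductOne hB0⟩

end Signed

/-! ### Relations that mix rotations and reflections -/

section Reflections

variable {n : ℕ}

theorem exists_pair_add_eq [NeZero n] {D : Multiset (ZMod n)} (hD : D.Nodup)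
    (h : n < 2 * D.card) {x₁ x₂ : ZMod n} (hx : x₁ ≠ x₂) :
    ∃ y₁ y₂ R, D = {y₁, y₂} + R ∧ x₁ + y₁ = x₂ + y₂ := by
  set F : Finset (ZMod n) := ⟨D, hD⟩ with hF
  have hFc : F.card = D.card := rfl
  have hnd : ¬ Disjoint (F.image (x₁ + ·)) (F.image (x₂ + ·)) := by
    intro hdis
    have h1 := Finset.card_union_of_disjoint hdis
    rw [Finset.card_image_of_injective _ (add_right_injective x₁),
      Finset.card_image_of_injective _ (add_right_injective x₂)] at h1
    have h2 := Finset.card_le_univ (F.image (x₁ + ·) ∪ F.image (x₂ + ·))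
    rw [ZMod.card] at h2
    omega
  obtain ⟨z, hz₁, hz₂⟩ := Finset.not_disjoint_iff.1 hnd
  obtain ⟨y₁, hy₁, rfl⟩ := Finset.mem_image.1 hz₁
  obtain ⟨y₂, hy₂, hy⟩ := Finset.mem_image.1 hz₂
  have hne : y₁ ≠ y₂ := by
    rintro rfl
    exact hx (add_right_cancel hy.symm)
  have hle : ({y₁, y₂} : Multiset (ZMod n)) ≤ D := by
    refine (Multiset.le_iff_subset (by simpa using hne)).2 ?_
    intro a ha
    simp only [Multiset.insert_eq_cons, Multiset.mem_cons, Multiset.mem_singleton] at ha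
    rcases ha with rfl | rfl <;> assumption
  exact ⟨y₁, y₂, D - {y₁, y₂}, (add_tsub_cancel_of_le hle).symm, hy.symm⟩

theorem exists_pair_of_two_le {α : Type*} {D : Multiset α} (h : 2 ≤ D.card) :
    ∃ x y R, D = {x, y} + R := by
  obtain ⟨x, hx⟩ := Multiset.card_pos_iff_exists_mem.1 (show 0 < D.card by omega)
  obtain ⟨R, rfl⟩ := Multiset.exists_cons_of_mem hx
  rw [Multiset.card_cons] at h
  obtain ⟨y, hy⟩ := Multiset.card_pos_iff_exists_mem.1 (show 0 < R.card by omega)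
  obtain ⟨R, rfl⟩ := Multiset.exists_cons_of_mem hy
  exact ⟨x, y, R, by simp [Multiset.insert_eq_cons]⟩

/-- If `D` is more than half of `ZMod n`, its translates by two rotations meet. Otherwise `C`
represents every class up to sign, in particular `0` and the difference of two reflections. -/
theorem exists_mixed [NeZero n] (hn : 3 ≤ n) {C D : Multiset (ZMod n)}
    (hC : (C.map signClass).Nodup) (hD : D.Nodup) (hC2 : 2 ≤ C.card)
    (h : C.card + D.card = n + 1) :
    ∃ x₁ x₂ R y₁ y₂ R', C = {x₁, x₂} + R ∧ D = {y₁, y₂} + R' ∧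
      SignedZeroSum {x₁, x₂} {y₁, y₂} := by
  have hCc := card_le_of_nodup_signClass hC
  rcases Nat.lt_or_ge n (2 * D.card) with hlt | hge
  · obtain ⟨x₁, x₂, R, rfl⟩ := exists_pair_of_two_le hC2
    have hx : x₁ ≠ x₂ := by
      have := (Multiset.nodup_add.1 (Multiset.Nodup.of_map _ hC)).1
      simpa using this
    obtain ⟨y₁, y₂, R', hR', hy⟩ := exists_pair_add_eq hD hlt hx
    exact ⟨x₁, x₂, R, y₁, y₂, R', rfl, hR', signedZeroSum_mixed hy⟩
  · obtain ⟨y₁, y₂, R', rfl⟩ := exists_pair_of_two_le (D := D) (by omega)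
    have hy : y₁ ≠ y₂ := by simpa using (Multiset.nodup_add.1 hD).1
    obtain ⟨z, hz, hz0⟩ := exists_mem_signClass hC (by omega) 0
    obtain rfl : z = 0 := by
      rcases hz0 with h | h
      · exact h.symm
      · exact (neg_eq_zero.1 h.symm)
    obtain ⟨x, hx, hxy⟩ := exists_mem_signClass hC (by omega) (y₁ - y₂)
    have hx0 : x ≠ 0 := by
      rintro rfl
      exact hy (sub_eq_zero.1 (by simpa using hxy))
    have hle : ({x, 0} : Multiset (ZMod n)) ≤ C := by
      refine (Multiset.le_iff_subset (by simpa using hx0)).2 ?_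
      intro a ha
      simp only [Multiset.insert_eq_cons, Multiset.mem_cons, Multiset.mem_singleton] at ha
      rcases ha with rfl | rfl <;> assumption
    refine ⟨x, 0, C - {x, 0}, y₁, y₂, R', (add_tsub_cancel_of_le hle).symm, rfl, ?_⟩
    rcases hxy with h | h
    · rw [Multiset.pair_comm x]
      exact signedZeroSum_mixed (by rw [← h]; abel)
    · exact signedZeroSum_mixed (by rw [← neg_eq_iff_eq_neg.2 h]; abel)

theorem exists_signedZeroSum_of_coeff {u v y₁ y₂ : ZMod n} {k p₁ m₁ p₂ m₂ : ℕ}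
    (hu : p₁ + m₁ ≤ k) (hv : p₂ + m₂ ≤ k)
    (h : (p₁ : ZMod n) * u + p₂ * v + y₁ = m₁ * u + m₂ * v + y₂) :
    ∃ A₀ ≤ Multiset.replicate k u + Multiset.replicate k v,
      A₀.card = p₁ + m₁ + (p₂ + m₂) ∧ SignedZeroSum A₀ {y₁, y₂} := by
  refine ⟨Multiset.replicate (p₁ + m₁) u + Multiset.replicate (p₂ + m₂) v,
    add_le_add ((Multiset.replicate_le_replicate u).2 hu)
      ((Multiset.replicate_le_replicate v).2 hv), by simp,
    Multiset.replicate p₁ u + Multiset.replicate p₂ v,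
    Multiset.replicate m₁ u + Multiset.replicate m₂ v, {y₁}, {y₂}, ?_,
    by simp [Multiset.insert_eq_cons], rfl, ?_⟩
  · rw [Multiset.replicate_add, Multiset.replicate_add]
    abel
  · simpa using h

/-- Write `y₂ - y₁ = d * (v - u)`, with `d ≤ k` after a possible swap. Taking `u` with net
coefficient `-d` and `v` with `d` works for `d < k`; the surplus terms cancel in pairs, distributed
according to the parity of `k - d`. -/
theorem exists_signedZeroSum_replicate {k : ℕ} (hk : 2 ≤ k) {u v : ZMod (2 * k)}
    (huv : IsUnit (v - u)) {y₁ y₂ : ZMod (2 * k)} (hy : y₁ ≠ y₂) :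
    ∃ A₀ ≤ Multiset.replicate k u + Multiset.replicate k v,
      A₀.card + 2 = 2 * k ∧ SignedZeroSum A₀ {y₁, y₂} := by
  have : NeZero (2 * k) := ⟨by omega⟩
  have h2k : (2 : ZMod (2 * k)) * k = 0 := by
    have := ZMod.natCast_self (2 * k)
    rwa [Nat.cast_mul, Nat.cast_ofNat] at this
  have hmul : ∀ x : ZMod (2 * k), ∃ d : ℕ, d < 2 * k ∧ x = d * (v - u) := by
    intro x
    obtain ⟨b, hb⟩ := huv.exists_left_inv
    refine ⟨(x * b).val, ZMod.val_lt _, ?_⟩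
    rw [ZMod.natCast_zmod_val, mul_assoc, hb, mul_one]
  have key : ∀ y₁ y₂ : ZMod (2 * k), ∀ d : ℕ, 0 < d → d ≤ k → y₂ - y₁ = d * (v - u) →
      ∃ A₀ ≤ Multiset.replicate k u + Multiset.replicate k v,
        A₀.card + 2 = 2 * k ∧ SignedZeroSum A₀ {y₁, y₂} := by
    intro y₁ y₂ d hd hdk hyd
    suffices h : ∃ p₁ m₁ p₂ m₂ : ℕ, p₁ + m₁ ≤ k ∧ p₂ + m₂ ≤ k ∧
        p₁ + m₁ + (p₂ + m₂) + 2 = 2 * k ∧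
        (p₁ : ZMod (2 * k)) * u + p₂ * v + y₁ = m₁ * u + m₂ * v + y₂ by
      obtain ⟨p₁, m₁, p₂, m₂, h1, h2, h3, h4⟩ := h
      obtain ⟨A₀, hA, hc, hs⟩ := exists_signedZeroSum_of_coeff h1 h2 h4
      exact ⟨A₀, hA, by omega, hs⟩
    rcases hdk.lt_or_eq with hlt | rfl
    · rcases Nat.even_or_odd' (k - d) with ⟨e, he | he⟩
      · obtain ⟨f, rfl⟩ : ∃ f, e = f + 1 := ⟨e - 1, by omega⟩
        refine ⟨f, d + f, d + f + 1, f + 1, by omega, by omega, by omega, ?_⟩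
        push_cast
        linear_combination -hyd
      · refine ⟨e, d + e, d + e, e, by omega, by omega, by omega, ?_⟩
        push_cast
        linear_combination -hyd
    -- For `d = k` all `2 * k` terms would be used, two too many. The relation `2 * u = 2 * μ * (v -
    -- u)`, with `μ` the residue of `c` modulo `k`, gives other coefficients with `2 * k - 2` terms.
    · obtain ⟨c, hc, hcu⟩ := hmul u
      have hμ : ∃ μ < d, 2 * u = 2 * μ * (v - u) := by
        rcases Nat.lt_or_ge c d with h | h
        · exact ⟨c, h, by rw [mul_assoc, ← hcu]⟩
        · refine ⟨c - d, by omega, ?_⟩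
          rw [Nat.cast_sub h]
          linear_combination 2 * hcu + (v - u) * h2k
      obtain ⟨μ, hμd, hμ⟩ := hμ
      rcases Nat.eq_zero_or_pos μ with rfl | hpos
      · obtain ⟨f, rfl⟩ : ∃ f, d = f + 2 := ⟨d - 2, by omega⟩
        refine ⟨0, f, f + 2, 0, by omega, by omega, by omega, ?_⟩
        push_cast at hyd hμ ⊢
        linear_combination -hyd + hμ
      · obtain ⟨f, rfl⟩ : ∃ f, d = μ + 1 + f := ⟨d - 1 - μ, by omega⟩
        obtain ⟨ν, rfl⟩ : ∃ ν, μ = ν + 1 := ⟨μ - 1, by omega⟩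
        refine ⟨ν + 2, f, f, ν, by omega, by omega, by omega, ?_⟩
        push_cast at hyd hμ ⊢
        linear_combination -hyd + hμ
  obtain ⟨d, hd, hyd⟩ := hmul (y₂ - y₁)
  have hd0 : 0 < d := by
    rcases Nat.eq_zero_or_pos d with rfl | h
    · exact absurd (sub_eq_zero.1 (by simpa using hyd)).symm hy
    · exact h
  rcases Nat.lt_or_ge k d with hkd | hkd
  · rw [Multiset.pair_comm]
    refine key y₂ y₁ (2 * k - d) (by omega) (by omega) ?_
    rw [Nat.cast_sub hd.le]
    push_cast
    linear_combination -hyd - (v - u) * h2k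
  · exact key y₁ y₂ d hd0 hkd hyd

/-- Few reflections: differences of reflections meet differences of short subsums. -/
theorem exists_sum_add_eq [NeZero n] {T D : Multiset (ZMod n)} {h : ℕ} (hD : D.Nodup)
    (hTD : n ≤ T.card + D.card) (hD2 : 2 ≤ D.card) (hT0 : T ≠ 0) (hh : 0 < h)
    (hc : ∀ e, T.count e ≤ h) (hz : ∀ V ≤ T, V ≠ 0 → V.card ≤ h → V.sum ≠ 0) :
    ∃ W₁ W₂ y₁ y₂ R, W₁ + W₂ ≤ T ∧ W₂.card ≤ W₁.card ∧ W₁.card ≤ h ∧ D = {y₁, y₂} + R ∧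
      W₁.sum + y₁ = W₂.sum + y₂ := by
  suffices hs : ∃ W₁ W₂ y₁ y₂, W₁ + W₂ ≤ T ∧ W₂.card ≤ W₁.card ∧ W₁.card ≤ h ∧ y₁ ∈ D ∧ y₂ ∈ D ∧
      y₁ ≠ y₂ ∧ W₁.sum + y₁ = W₂.sum + y₂ by
    obtain ⟨W₁, W₂, y₁, y₂, h1, h2, h3, hy₁, hy₂, hne, h4⟩ := hs
    have hle : ({y₁, y₂} : Multiset (ZMod n)) ≤ D := by
      refine (Multiset.le_iff_subset (by simpa using hne)).2 ?_
      intro a ha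
      simp only [Multiset.insert_eq_cons, Multiset.mem_cons, Multiset.mem_singleton] at ha
      rcases ha with rfl | rfl <;> assumption
    exact ⟨W₁, W₂, y₁, y₂, D - {y₁, y₂}, h1, h2, h3, (add_tsub_cancel_of_le hle).symm, h4⟩
  obtain ⟨x, hx⟩ := Multiset.exists_mem_of_ne_zero hT0
  have hxT : ({x} : Multiset (ZMod n)) ≤ T := Multiset.singleton_le.2 hx
  have hx0 : x ≠ 0 := by simpa using hz {x} hxT (by simp) (by simpa using Nat.succ_le_of_lt hh)
  obtain ⟨y₀, y₁, R, hR⟩ := exists_pair_of_two_le hD2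
  have hy₀ : y₀ ∈ D := by rw [hR]; simp
  have hy₁ : y₁ ∈ D := by rw [hR]; simp
  have hy : y₀ ≠ y₁ := by
    rw [hR] at hD
    simpa using (Multiset.nodup_add.1 hD).1
  set F : Finset (ZMod n) := ⟨D, hD⟩ with hF
  have hFc : F.card = D.card := rfl
  set E := F.image (· - y₀) with hE
  have hEc : E.card = D.card := by
    rw [hE, Finset.card_image_of_injective _ (sub_left_injective), hFc]
  have hX := card_lt_card_boundedSums hc hz
  by_cases hE1 : x + (y₁ - y₀) ∈ E
  · obtain ⟨y, hyF, hyx⟩ := Finset.mem_image.1 hE1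
    have hyx' : x + y₁ = y := by linear_combination -hyx
    refine ⟨{x}, 0, y₁, y, by simpa using hx, by simp, by simpa using Nat.succ_le_of_lt hh,
      hy₁, hyF, ?_, by simpa⟩
    rintro rfl
    exact hx0 (by simpa using hyx')
  by_cases hE2 : ∃ e ∈ E ∩ boundedSums h T, e ≠ 0
  · obtain ⟨e, he, he0⟩ := hE2
    rw [Finset.mem_inter] at he
    obtain ⟨y, hyF, rfl⟩ := Finset.mem_image.1 he.1
    obtain ⟨W, hW, hWc, hWs⟩ := mem_boundedSums.1 he.2
    refine ⟨W, 0, y₀, y, by simpa using hW, by simp, hWc, hy₀, hyF, ?_, ?_⟩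
    · rintro rfl
      exact he0 (sub_self _)
    · rw [hWs]; simp
  -- Now `E` and the short sums meet at most in `0`, so by counting they cover the group. The test
  -- element `x + (y₁ - y₀)` must be a short sum, and `x` is cancelled from it or moved to the other
  -- side.
  push Not at hE2
  have hEX : (E ∩ boundedSums h T).card ≤ 1 := by
    refine Finset.card_le_one.2 fun a ha b hb => ?_
    rw [hE2 a ha, hE2 b hb]
  have huniv : E ∪ boundedSums h T = Finset.univ := by
    apply Finset.eq_univ_of_card
    have h1 := Finset.card_union_add_card_inter E (boundedSums h T)
    have h2 := Finset.card_le_univ (E ∪ boundedSums h T)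
    rw [ZMod.card] at h2 ⊢
    omega
  have hmem : x + (y₁ - y₀) ∈ boundedSums h T := by
    have : x + (y₁ - y₀) ∈ E ∪ boundedSums h T := by rw [huniv]; simp
    exact (Finset.mem_union.1 this).resolve_left hE1
  obtain ⟨W, hW, hWc, hWs⟩ := mem_boundedSums.1 hmem
  by_cases hxW : x ∈ W
  · obtain ⟨W', rfl⟩ := Multiset.exists_cons_of_mem hxW
    refine ⟨W', 0, y₀, y₁, ?_, by simp, ?_, hy₀, hy₁, hy, ?_⟩
    · simpa using (Multiset.le_cons_self W' x).trans hW
    · rw [Multiset.card_cons] at hWc; omega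
    · rw [Multiset.sum_cons] at hWs
      simp only [Multiset.sum_zero]
      linear_combination hWs
  · by_cases hW0 : W = 0
    · subst hW0
      refine ⟨{x}, 0, y₁, y₀, by simpa using hx, by simp, by simpa using Nat.succ_le_of_lt hh,
        hy₁, hy₀, hy.symm, ?_⟩
      simp only [Multiset.sum_zero, Multiset.sum_singleton] at hWs ⊢
      linear_combination -hWs
    · refine ⟨W, {x}, y₀, y₁, ?_, ?_, hWc, hy₀, hy₁, hy, ?_⟩
      · rw [add_comm, Multiset.singleton_add]
        obtain ⟨T', rfl⟩ := Multiset.exists_cons_of_mem hx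
        exact Multiset.cons_le_cons _ ((Multiset.le_cons_of_notMem hxW).1 hW)
      · simpa using Nat.succ_le_of_lt (Multiset.card_pos.2 hW0)
      · rw [hWs, Multiset.sum_singleton]; abel

/-- To undo the translation by `u`, both sides need equally many rotations, so the side of `W₂` is
padded with copies of `u`. The remaining rotations are numerous enough to supply the missing pairs.
-/
theorem hasSigned_of_sum_add_eq [NeZero n] {A D T W₁ W₂ R : Multiset (ZMod n)}
    {u y₁ y₂ : ZMod n} {h k : ℕ} (hA : A = Multiset.replicate h u + T.map (· + u))
    (hD : D = {y₁, y₂} + R) (hW : W₁ + W₂ ≤ T) (h21 : W₂.card ≤ W₁.card) (h1 : W₁.card ≤ h)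
    (h1k : W₁.card + 1 ≤ k) (hs : W₁.sum + y₁ = W₂.sum + y₂) (hDn : 2 * D.card ≤ n)
    (hcard : n + 2 * k ≤ A.card + D.card + 1) : HasSigned A D (2 * k) := by
  set A₁ := W₁.map (· + u) with hA₁
  set A₂ := W₂.map (· + u) + Multiset.replicate (W₁.card - W₂.card) u with hA₂
  have hSZ : SignedZeroSum (A₁ + A₂) {y₁, y₂} := by
    refine ⟨A₁, A₂, {y₁}, {y₂}, rfl, by simp [Multiset.insert_eq_cons], rfl, ?_⟩
    simp only [hA₁, hA₂, Multiset.sum_map_add, Multiset.sum_add, Multiset.map_id',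
      Multiset.map_const', Multiset.sum_replicate, Multiset.sum_singleton, nsmul_eq_mul,
      Nat.cast_sub h21]
    linear_combination hs
  have hle : A₁ + A₂ ≤ A := by
    rw [hA, hA₂, ← add_assoc, ← Multiset.map_add, add_comm]
    exact add_le_add ((Multiset.replicate_le_replicate u).2 (by omega)) (Multiset.map_le_map hW)
  have hAc : (A₁ + A₂).card = 2 * W₁.card := by
    simp [hA₁, hA₂]; omega
  obtain ⟨P, rfl⟩ := Multiset.le_iff_exists_add.1 hle
  rw [hD] at hcard hDn
  simp only [Multiset.card_add, Multiset.card_pair] at hcard hAc hDn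
  have hP : HasPairs (k - 1 - W₁.card) P := hasPairs_of_card (by omega)
  refine hSZ.hasSigned (Q := 0) (s := k - 1 - W₁.card) (by simp) hP le_rfl ?_ (by simp) ?_
  · rw [hD]; simp
  · simp only [Multiset.card_add, Multiset.card_pair]
    omega

theorem hasSigned_of_few_reflections [NeZero n] {k : ℕ} (hk2 : 2 ≤ k)
    (hk : n = 2 * k ∨ n = k) {A D : Multiset (ZMod n)} (hD : D.Nodup) (hD2 : 2 ≤ D.card)
    (hDn : 2 * D.card ≤ n) (hcard : A.card + D.card + 1 = n + 2 * k)
    (hno : ∀ W ≤ A, W.card = 2 * k → W.sum ≠ 0) : HasSigned A D (2 * k) := by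
  have hA0 : A ≠ 0 := by rintro rfl; simp at hcard; omega
  have hdvd : n ∣ 2 * k := by
    rcases hk with rfl | rfl
    · exact dvd_rfl
    · exact Dvd.intro_left _ rfl
  obtain ⟨u, h, T, hAT, hpos, hhL, hcount, hT⟩ := exists_translate hdvd hA0 hno
  obtain ⟨U, -, hUT, -, hUc, hU⟩ := exists_maximal_zeroSum (V := 0) (by simp) (by simp)
    (by simpa using Nat.succ_le_of_lt hhL) hT
  have hsub : T - U ≤ T := tsub_le_self
  have hc' : ∀ e, (T - U).count e ≤ h := fun e =>
    (Multiset.count_le_of_le e hsub).trans (hcount e)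
  have hTc : h + T.card = A.card := by rw [hAT]; simp
  have hUTc : (T - U).card + U.card = T.card := by
    rw [← Multiset.card_add, tsub_add_cancel_of_le hUT]
  have hlt := card_lt_card_boundedSums hc' hU
  have hle := Finset.card_le_univ (boundedSums h (T - U))
  rw [ZMod.card] at hle
  -- The two reflections leave room for `2 * k - 2` rotations, so the bound on `W₁` must be `k - 1`
  -- and multiplicities must not exceed it. A term of multiplicity `k` forces `n = 2 * k` and is a
  -- unit, since no short multiple of it vanishes; then `u` and `e + u` suffice.
  by_cases he : ∃ e, k ≤ (T - U).count e
  · obtain ⟨e, he⟩ := he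
    have hce := Multiset.count_le_card e (T - U)
    obtain rfl : n = 2 * k := hk.resolve_right (by omega)
    have hkh := he.trans (hc' e)
    have hne : ∀ j : ℕ, 0 < j → j ≤ k → (j : ZMod (2 * k)) * e ≠ 0 := by
      intro j hj hjk
      have := hU (Multiset.replicate j e) (Multiset.le_count_iff_replicate_le.1 (hjk.trans he))
        (by rw [← Multiset.card_pos]; simpa using hj) (by simp; omega)
      simpa using this
    have hunit : IsUnit e := by
      refine isUnit_of_mul_ne_zero fun j hj hjn hj0 => ?_
      rcases Nat.lt_or_ge k j with hjk | hjk
      · refine hne (2 * k - j) (by omega) (by omega) ?_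
        rw [Nat.cast_sub hjn.le, sub_mul, hj0, ZMod.natCast_self]
        simp
      · exact hne j hj hjk hj0
    obtain ⟨y₁, y₂, R, rfl⟩ := exists_pair_of_two_le hD2
    have hy : y₁ ≠ y₂ := by simpa using (Multiset.nodup_add.1 hD).1
    obtain ⟨A₀, hA₀, hA₀c, hA₀s⟩ := exists_signedZeroSum_replicate hk2 (u := u) (v := e + u)
      (by simpa using hunit) hy
    refine ⟨A₀, hA₀.trans ?_, _, Multiset.le_add_right _ _, hA₀s, by simp, by simpa using hA₀c⟩
    rw [hAT]
    refine add_le_add ((Multiset.replicate_le_replicate u).2 hkh) ?_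
    rw [← Multiset.map_replicate (· + u)]
    exact Multiset.map_le_map ((Multiset.le_count_iff_replicate_le.1 he).trans hsub)
  · push Not at he
    have hmin : min h (k - 1) ≤ h := min_le_left _ _
    obtain ⟨W₁, W₂, y₁, y₂, R, hW, h21, h1, hDR, hs⟩ := exists_sum_add_eq (T := T - U)
      (h := min h (k - 1)) hD (by omega) hD2
      (by rw [← Multiset.card_pos]; omega) (by omega)
      (fun e => le_min (hc' e) (by have := he e; omega))
      (fun V hV hV0 hVc => hU V hV hV0 (hVc.trans hmin))
    exact hasSigned_of_sum_add_eq hAT hDR (hW.trans hsub) h21 (by omega) (by omega) hs hDn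
      (by omega)

end Reflections

/-! ### Two or more reflections -/

section Combinatorics

variable {n : ℕ}

theorem card_le_of_nodup [NeZero n] {D : Multiset (ZMod n)} (hD : D.Nodup) : D.card ≤ n := by
  have := Finset.card_le_univ (⟨D, hD⟩ : Finset (ZMod n))
  rwa [ZMod.card] at this

theorem exists_ne_or_eq_replicate {α : Type*} {A : Multiset α} (hA : A ≠ 0) :
    (∃ x y R, A = {x, y} + R ∧ x ≠ y) ∨ ∃ x, A = Multiset.replicate A.card x := by
  obtain ⟨x, hx⟩ := Multiset.exists_mem_of_ne_zero hA
  by_cases h : ∃ y ∈ A, y ≠ x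
  · obtain ⟨y, hy, hyx⟩ := h
    obtain ⟨R, rfl⟩ := Multiset.exists_cons_of_mem hx
    obtain ⟨R, rfl⟩ := Multiset.exists_cons_of_mem ((Multiset.mem_cons.1 hy).resolve_left hyx)
    exact Or.inl ⟨x, y, R, by simp [Multiset.insert_eq_cons], hyx.symm⟩
  · push Not at h
    exact Or.inr ⟨x, Multiset.eq_replicate.2 ⟨rfl, h⟩⟩

/-- Here `D` is all of `ZMod 3`. A repeated reflection `y` gives `y + y = (y + 1) + (y + 2)`;
without one, two different rotations, or four copies of a nonzero one, are balanced by a difference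
in `D`. -/
theorem hasSigned_zmod_three {A P C Q D : Multiset (ZMod 3)} {r : ℕ} (hA : A = P + C)
    (hP : HasPairs r P) (hD : D.Nodup) (hD3 : D.card = 3) (hPc : P.card = 2 * r)
    (hC : C.card = 1) (hr : r + Q.card = 2) :
    HasSigned A (Q + Q + D) 6 ∨ (A = Multiset.replicate 5 0 ∧ Q = 0) := by
  have hmemD : ∀ x, x ∈ D := by
    intro x
    have : (⟨D, hD⟩ : Finset (ZMod 3)) = Finset.univ :=
      Finset.eq_univ_of_card _ (by rw [ZMod.card]; exact hD3)
    have hx := Finset.mem_univ x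
    rw [← this] at hx
    exact hx
  by_cases hQ : Q = 0
  · subst hQ
    simp only [Multiset.card_zero, add_zero, zero_add] at hr ⊢
    subst hr
    have hAc : A.card = 5 := by rw [hA, Multiset.card_add]; omega
    rcases exists_ne_or_eq_replicate (A := A) (by rintro rfl; simp at hAc) with
      ⟨x₁, x₂, A', hA', hx⟩ | ⟨x, hx⟩
    · left
      obtain ⟨y₁, y₂, R, rfl, hy⟩ := exists_pair_add_eq hD (by omega) hx
      rw [hA', Multiset.card_add, Multiset.card_pair] at hAc
      exact (signedZeroSum_mixed hy).hasSigned (Q := 0) (s := 1) (by simp)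
        (hasPairs_of_card (i := 1) (by omega)) hA'.ge (by simp) (by simp) (by simp)
    · rw [hAc] at hx
      by_cases hx0 : x = 0
      · subst hx0
        exact Or.inr ⟨hx, trivial⟩
      · left
        obtain ⟨y₁, y₂, R, rfl, hy⟩ := exists_pair_add_eq hD (by omega) hx0
        refine ⟨Multiset.replicate 4 x, ?_, {y₁, y₂}, Multiset.le_add_right _ _,
          ⟨Multiset.replicate 4 x, 0, {y₁}, {y₂}, by simp, by simp [Multiset.insert_eq_cons],
            rfl, ?_⟩, by simp, by simp⟩
        · rw [hx]
          exact (Multiset.replicate_le_replicate x).2 (by omega)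
        · have h3 : (3 : ZMod 3) = 0 := by decide
          simp only [Multiset.sum_replicate, nsmul_eq_mul, Multiset.sum_singleton,
            Multiset.sum_zero]
          push_cast
          linear_combination hy + x * h3
  · left
    obtain ⟨y, hy⟩ := Multiset.exists_mem_of_ne_zero hQ
    obtain ⟨Q', rfl⟩ := Multiset.exists_cons_of_mem hy
    have hle : ({y + 1, y + 2} : Multiset (ZMod 3)) ≤ D := by
      refine (Multiset.le_iff_subset ?_).2 fun a _ => hmemD a
      simp only [Multiset.insert_eq_cons, Multiset.nodup_cons, Multiset.mem_singleton,
        Multiset.nodup_singleton, and_true, add_right_inj]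
      decide
    have hs : y + y = (y + 1) + (y + 2) := by
      have h3 : (3 : ZMod 3) = 0 := by decide
      linear_combination -h3
    rw [Multiset.card_cons] at hr
    refine (signedZeroSum_quad hs).hasSigned (P := P) (Q := Q') (s := 1) (by simp) hP
      (by rw [hA, zero_add]; exact Multiset.le_add_right _ _) ?_ (by omega) (by simp)
    calc ({y, y, y + 1, y + 2} : Multiset (ZMod 3)) + (Q' + Q')
        = (y ::ₘ Q' + y ::ₘ Q') + {y + 1, y + 2} := by
          simp only [Multiset.insert_eq_cons, ← Multiset.singleton_add]
          abel
      _ ≤ _ := add_le_add_right hle _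

/-- Sequences with at least two reflections have product-one subsequences of length `2k`, with one
exception for `n = 3`. -/
theorem hasSigned_of_two_le_card [NeZero n] (hn : 3 ≤ n) {k : ℕ} (hk : n = 2 * k ∨ n = k)
    {A B : Multiset (ZMod n)} (hB : 2 ≤ B.card) (hAB : A.card + B.card + 1 = n + 2 * k) :
    HasSigned A B (2 * k) ∨ (∃ W ≤ A, W.card = 2 * k ∧ W.sum = 0) ∨
      (n = 3 ∧ k = 3 ∧ A = Multiset.replicate 5 0 ∧ B.Nodup ∧ B.card = 3) := by
  have hk2 : 2 ≤ k := by omega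
  obtain ⟨r, P, C, rfl, hPc, hP, hC⟩ := exists_pairs_add A
  obtain ⟨Q, D, rfl, hD⟩ := exists_double_add B
  have hCc := card_le_of_nodup_signClass hC
  have hDc := card_le_of_nodup hD
  simp only [Multiset.card_add] at hAB hB
  rcases Nat.lt_or_ge (r + Q.card) k with hlt | hge
  · obtain ⟨m, hm⟩ : ∃ m, k = m + (r + Q.card) := ⟨k - (r + Q.card), by omega⟩
    rcases Nat.even_or_odd' m with ⟨j, rfl | rfl⟩
    · left
      -- The bound `n / 2 + 1` on the unpaired rotations leaves just enough distinct reflections to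
      -- replace the `2 * j` missing pairs by `j` quadruples.
      obtain ⟨D₀, R, rfl, hD₀c, hD₀⟩ := exists_quads hD (j := j) (by omega)
      refine hD₀.hasSigned (P := P) (Q := Q) (s := r + Q.card)
        (by rw [← Multiset.card_pos]; omega) hP
        (by rw [zero_add]; exact Multiset.le_add_right _ _) ?_ le_rfl (by simp; omega)
      rw [show Q + Q + (D₀ + R) = D₀ + (Q + Q) + R by abel]
      exact Multiset.le_add_right _ _
    · rcases Nat.lt_or_ge C.card 2 with hC1 | hC2
      -- With at most one unpaired rotation, `D` is all of `ZMod n`; a quadruple replaces the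
      -- missing pair and one further pair, but needs `n ≥ 4`.
      · obtain rfl : j = 0 := by omega
        rcases Nat.lt_or_ge 3 n with hn4 | hn3
        · left
          obtain ⟨D₀, R, rfl, hD₀c, hD₀⟩ := exists_quads hD (j := 1) (by omega)
          refine hD₀.hasSigned (P := P) (Q := Q) (s := r + Q.card - 1)
            (by rw [← Multiset.card_pos]; omega) hP
            (by rw [zero_add]; exact Multiset.le_add_right _ _) ?_ (by omega) (by simp; omega)
          rw [show Q + Q + (D₀ + R) = D₀ + (Q + Q) + R by abel]
          exact Multiset.le_add_right _ _
        · obtain rfl : n = 3 := by omega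
          obtain rfl : k = 3 := by omega
          have hD3 : D.card = 3 := by omega
          have hC1 : C.card = 1 := by omega
          rcases hasSigned_zmod_three rfl hP hD hD3 hPc hC1
            (show r + Q.card = 2 by omega) with h | ⟨h, rfl⟩
          · exact Or.inl h
          · exact Or.inr (Or.inr ⟨rfl, rfl, h, by simpa using hD, by simp; omega⟩)
      · left
        obtain ⟨D₀, R, rfl, hD₀c, hD₀⟩ := exists_quads hD (j := j) (by omega)
        simp only [Multiset.card_add] at hAB hDc
        -- With no pairs at all, the bounds on `C` and `D` would give `4 * j ≤ n / 2 ≤ k = 2 * j +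
        -- 1`, hence `k = 1`.
        have hrQ : 1 ≤ r + Q.card := by omega
        obtain ⟨x₁, x₂, C', y₁, y₂, R', rfl, rfl, hxy⟩ := exists_mixed hn hC
          (Multiset.nodup_add.1 hD).2.1 hC2 (by omega)
        have hSZ := hxy.add hD₀
        rw [add_zero] at hSZ
        refine hSZ.hasSigned (P := P) (Q := Q) (s := r + Q.card - 1) (by simp) hP ?_ ?_
          (by omega) (by simp; omega)
        · rw [add_comm, ← add_assoc]
          exact Multiset.le_add_right _ _
        · rw [show Q + Q + (D₀ + ({y₁, y₂} + R')) = {y₁, y₂} + D₀ + (Q + Q) + R' by abel]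
          exact Multiset.le_add_right _ _
  · by_cases hQ : Q = 0
    · subst hQ
      simp only [Multiset.card_zero, add_zero, zero_add] at hB hAB hge ⊢
      by_cases hno : ∃ W ≤ P + C, W.card = 2 * k ∧ W.sum = 0
      · exact Or.inr (Or.inl hno)
      push Not at hno
      left
      rcases Nat.lt_or_ge n (2 * D.card) with hDn | hDn
      · have hPC := hP.add C
        have hPCc : (P + C).card = P.card + C.card := Multiset.card_add _ _
        set A := P + C
        rcases exists_ne_or_eq_replicate (A := A)
          (by rw [← Multiset.card_pos]; omega) with ⟨x₁, x₂, A', hA', hx⟩ | ⟨x, hx⟩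
        · obtain ⟨y₁, y₂, R, rfl, hy⟩ := exists_pair_add_eq hD hDn hx
          -- Taking out `x₁` and `x₂` costs at most two of the `r ≥ k` pairs; `k - 2` are needed.
          rw [hA', show r = r - 2 + 1 + 1 by omega] at hPC
          have hA'p : HasPairs (r - 2) A' := by
            apply HasPairs.of_cons (z := x₂)
            apply HasPairs.of_cons (z := x₁)
            simpa [Multiset.insert_eq_cons] using hPC
          exact (signedZeroSum_mixed hy).hasSigned (Q := 0) (s := k - 2) (by simp) hA'p hA'.ge
            (by simp) (by omega) (by simp; omega)
        · exfalso
          refine hno (Multiset.replicate (2 * k) x) ?_ (by simp) ?_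
          · rw [hx]
            exact (Multiset.replicate_le_replicate x).2 (by omega)
          · rw [Multiset.sum_replicate, nsmul_eq_mul]
            rcases hk with h | h
            · rw [← h, ZMod.natCast_self, zero_mul]
            · rw [← h, Nat.cast_mul, ZMod.natCast_self, mul_zero, zero_mul]
      · exact hasSigned_of_few_reflections hk2 hk hD hB hDn
          (by rw [Multiset.card_add]; omega) hno
    · left
      obtain ⟨y, hy⟩ := Multiset.exists_mem_of_ne_zero hQ
      obtain ⟨Q', rfl⟩ := Multiset.exists_cons_of_mem hy
      rw [Multiset.card_cons] at hge
      refine (signedZeroSum_double {y}).hasSigned (P := P) (Q := Q') (s := k - 1) (by simp) hP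
        (by rw [zero_add]; exact Multiset.le_add_right _ _) ?_ (by omega) (by simp; omega)
      rw [show y ::ₘ Q' + y ::ₘ Q' + D = {y} + {y} + (Q' + Q') + D by
        simp only [← Multiset.singleton_add]; abel]
      exact Multiset.le_add_right _ _

end Combinatorics

/-! ### Upper bound and structure of extremal sequences -/

section Rotations

variable {n : ℕ}

theorem hasProductOneSubseq_of_sum_eq_zero {A B W : Multiset (ZMod n)} {L : ℕ} (hW : W ≤ A)
    (hc : W.card = L) (hs : W.sum = 0) :
    HasProductOneSubseq (A.map DihedralGroup.r + B.map DihedralGroup.sr) L := by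
  refine ⟨W.map DihedralGroup.r, (Multiset.map_le_map hW).trans (Multiset.le_add_right _ _),
    by simpa using hc, W.toList.map DihedralGroup.r, ?_, ?_⟩
  · rw [← Multiset.map_coe, Multiset.coe_toList]
  · rw [prod_map_r, Multiset.sum_toList, hs, DihedralGroup.r_zero]

theorem exists_map_r_add_map_sr (S : Multiset (DihedralGroup n)) :
    ∃ A B : Multiset (ZMod n), S = A.map DihedralGroup.r + B.map DihedralGroup.sr := by
  induction S using Multiset.induction_on with
  | empty => exact ⟨0, 0, by simp⟩
  | cons x S ih =>
    obtain ⟨A, B, rfl⟩ := ih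
    cases x with
    | r i => exact ⟨i ::ₘ A, B, by simp⟩
    | sr i => exact ⟨A, i ::ₘ B, by simp⟩

theorem exists_zeroSum_two_mul [NeZero n] {k : ℕ} (hk : n = 2 * k ∨ n = k)
    {A : Multiset (ZMod n)} (hA : n + 2 * k ≤ A.card + 1) :
    ∃ W ≤ A, W.card = 2 * k ∧ W.sum = 0 := by
  rcases hk with h | rfl
  · rw [← h]
    exact exists_zeroSum_of_card (by omega)
  · exact exists_zeroSum_two_mul_of_card (by omega)

theorem eq_replicate_of_forall_two_mul [NeZero n] (hn : 3 ≤ n) {k : ℕ} (hk : n = 2 * k ∨ n = k)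
    {A : Multiset (ZMod n)} (hA : A.card + 2 = n + 2 * k)
    (hno : ∀ W ≤ A, W.card = 2 * k → W.sum ≠ 0) :
    ∃ u v : ZMod n, IsUnit (v - u) ∧
      A = Multiset.replicate (2 * k - 1) u + Multiset.replicate (n - 1) v := by
  rcases hk with h | rfl
  · rw [← h] at hno hA ⊢
    exact eq_replicate_of_forall_sum_ne_zero (by omega) (by omega) hno
  · exact eq_replicate_of_forall_sum_ne_zero_two_mul hn (by omega) hno

theorem structure_of_not_hasProductOneSubseq [NeZero n] (hn : 3 ≤ n) {k : ℕ}
    (hk : n = 2 * k ∨ n = k) {A B : Multiset (ZMod n)}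
    (hAB : A.card + B.card + 1 = n + 2 * k)
    (hno : ¬ HasProductOneSubseq (A.map DihedralGroup.r + B.map DihedralGroup.sr) (2 * k)) :
    (∃ u v y : ZMod n, IsUnit (v - u) ∧ B = {y} ∧
      A = Multiset.replicate (2 * k - 1) u + Multiset.replicate (n - 1) v) ∨
    (n = 3 ∧ k = 3 ∧ A = Multiset.replicate 5 0 ∧ B.Nodup ∧ B.card = 3) := by
  have hnoA : ∀ W ≤ A, W.card = 2 * k → W.sum ≠ 0 := fun W hW hc hs =>
    hno (hasProductOneSubseq_of_sum_eq_zero hW hc hs)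
  rcases Nat.lt_or_ge B.card 2 with hB | hB
  · rcases Nat.eq_zero_or_pos B.card with hB0 | hB0
    · obtain ⟨W, hW, hc, hs⟩ := exists_zeroSum_two_mul hk (A := A) (by omega)
      exact absurd hs (hnoA W hW hc)
    · obtain ⟨y, rfl⟩ := Multiset.card_eq_one.1 (show B.card = 1 by omega)
      obtain ⟨u, v, huv, hA⟩ := eq_replicate_of_forall_two_mul hn hk (A := A) (by omega) hnoA
      exact Or.inl ⟨u, v, y, huv, rfl, hA⟩
  · rcases hasSigned_of_two_le_card hn hk hB hAB with h | ⟨W, hW, hc, hs⟩ | h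
    · exact absurd h.hasProductOneSubseq hno
    · exact absurd hs (hnoA W hW hc)
    · exact Or.inr h

theorem hasProductOneSubseq_mono {G : Type*} [Group G] {S T : Multiset G} (h : S ≤ T) {m : ℕ}
    (hS : HasProductOneSubseq S m) : HasProductOneSubseq T m := by
  obtain ⟨U, hU, h'⟩ := hS
  exact ⟨U, hU.trans h, h'⟩

theorem hasProductOneSubseq_of_card [NeZero n] (hn : 3 ≤ n) {k : ℕ} (hk : n = 2 * k ∨ n = k)
    {S : Multiset (DihedralGroup n)} (hS : n + 2 * k ≤ S.card) :
    HasProductOneSubseq S (2 * k) := by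
  obtain ⟨S', hS', hc⟩ := exists_le_card_eq hS
  refine hasProductOneSubseq_mono hS' ?_
  obtain ⟨A, B, rfl⟩ := exists_map_r_add_map_sr S'
  simp only [Multiset.card_add, Multiset.card_map] at hc
  by_contra hno
  have hB : B ≠ 0 := by
    rintro rfl
    obtain ⟨W, hW, hWc, hWs⟩ := exists_zeroSum_two_mul hk (A := A) (by simp at hc; omega)
    exact hno (hasProductOneSubseq_of_sum_eq_zero hW hWc hWs)
  obtain ⟨y, hy⟩ := Multiset.exists_mem_of_ne_zero hB
  obtain ⟨B', rfl⟩ := Multiset.exists_cons_of_mem hy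
  rw [Multiset.card_cons] at hc
  -- Deleting a reflection shows that there are two or four reflections; deleting a rotation instead
  -- shows that there are one or three.
  have h1 : B'.card = 1 ∨ B'.card = 3 := by
    rcases structure_of_not_hasProductOneSubseq hn hk (A := A) (B := B') (by omega)
      (fun h => hno (hasProductOneSubseq_mono (add_le_add_right
        (Multiset.map_le_map (Multiset.le_cons_self _ _)) _) h)) with
      ⟨u, v, y, -, rfl, -⟩ | ⟨-, -, -, -, h⟩
    · exact Or.inl rfl
    · exact Or.inr h
  obtain ⟨x, hx⟩ := Multiset.card_pos_iff_exists_mem.1 (show 0 < A.card by omega)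
  obtain ⟨A', rfl⟩ := Multiset.exists_cons_of_mem hx
  rw [Multiset.card_cons] at hc
  rcases structure_of_not_hasProductOneSubseq hn hk (A := A') (B := y ::ₘ B')
    (by rw [Multiset.card_cons]; omega)
    (fun h => hno (hasProductOneSubseq_mono (add_le_add_left
      (Multiset.map_le_map (Multiset.le_cons_self _ _)) _) h)) with
    ⟨u, v, z, -, hB', -⟩ | ⟨-, -, -, -, h⟩
  · have := congrArg Multiset.card hB'
    simp at this
    simp [this] at h1
  · rw [Multiset.card_cons] at h
    omega

end Rotations

/-! ### The extremal sequences have no product-one subsequence -/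

section Extremal

variable {n : ℕ}

/-- The homomorphism that sends rotations to `1` and reflections to `-1`. -/
def reflectionSign (n : ℕ) : DihedralGroup n →* ℤˣ where
  toFun x := match x with
    | .r _ => 1
    | .sr _ => -1
  map_one' := rfl
  map_mul' x y := by
    cases x <;> cases y <;>
      simp

@[simp] theorem reflectionSign_r (i : ZMod n) : reflectionSign n (.r i) = 1 := rfl
@[simp] theorem reflectionSign_sr (i : ZMod n) : reflectionSign n (.sr i) = -1 := rfl

theorem prod_map_eq_one_of_isProductOne {G H : Type*} [Group G] [CommGroup H] (f : G →* H)
    {T : Multiset G} (hT : IsProductOne T) : (T.map f).prod = 1 := by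
  obtain ⟨l, rfl, hl⟩ := hT
  rw [Multiset.map_coe, Multiset.prod_coe, ← map_list_prod, hl, map_one]

theorem even_card_of_isProductOne {A B : Multiset (ZMod n)}
    (h : IsProductOne (A.map DihedralGroup.r + B.map DihedralGroup.sr)) : Even B.card := by
  have := prod_map_eq_one_of_isProductOne (reflectionSign n) h
  simp only [Multiset.map_add, Multiset.map_map, Function.comp_def, reflectionSign_r,
    reflectionSign_sr, Multiset.map_const', Multiset.prod_add, Multiset.prod_replicate, one_pow,
    one_mul] at this
  by_contra hodd
  rw [Nat.not_even_iff_odd] at hodd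
  rw [hodd.neg_one_pow] at this
  exact absurd this (by decide)

theorem sum_eq_zero_of_isProductOne {A : Multiset (ZMod n)}
    (h : IsProductOne (A.map DihedralGroup.r)) : A.sum = 0 := by
  obtain ⟨l, hl, hp⟩ := h
  induction A using Quotient.inductionOn with | _ a
  have hperm : l.Perm (a.map DihedralGroup.r) := by
    rw [← Multiset.coe_eq_coe, hl]; rfl
  have hcomm : l.Pairwise Commute := by
    refine List.pairwise_of_forall_mem_list fun x hx y hy => ?_
    obtain ⟨i, -, rfl⟩ := List.mem_map.1 (hperm.subset hx)
    obtain ⟨j, -, rfl⟩ := List.mem_map.1 (hperm.subset hy)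
    change _ * _ = _ * _
    rw [DihedralGroup.r_mul_r, DihedralGroup.r_mul_r, add_comm]
  rw [hperm.prod_eq' hcomm, prod_map_r, ← DihedralGroup.r_zero, DihedralGroup.r.injEq] at hp
  simpa using hp

theorem exists_of_le_map {α γ : Type*} {f : α → γ} {A : Multiset α} {T : Multiset γ}
    (h : T ≤ A.map f) : ∃ A' ≤ A, A'.map f = T := by
  induction A using Multiset.induction_on generalizing T with
  | empty => exact ⟨0, le_rfl, by simpa using (h.antisymm (by simp)).symm⟩
  | cons a A ih =>
    rw [Multiset.map_cons] at h
    by_cases ha : f a ∈ T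
    · obtain ⟨T', rfl⟩ := Multiset.exists_cons_of_mem ha
      obtain ⟨A', hA', rfl⟩ := ih ((Multiset.cons_le_cons_iff _).1 h)
      exact ⟨a ::ₘ A', Multiset.cons_le_cons _ hA', Multiset.map_cons _ _ _⟩
    · obtain ⟨A', hA', rfl⟩ := ih ((Multiset.le_cons_of_notMem ha).1 h)
      exact ⟨A', hA'.trans (Multiset.le_cons_self _ _), rfl⟩

theorem exists_of_le_map_add_map {α β γ : Type*} {f : α → γ} {g : β → γ} {A : Multiset α}
    {B : Multiset β} {T : Multiset γ} (h : T ≤ A.map f + B.map g) :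
    ∃ A' ≤ A, ∃ B' ≤ B, T = A'.map f + B'.map g := by
  classical
  have h1 : T ∩ A.map f ≤ A.map f := Multiset.inter_le_right
  have h2 : T - A.map f ≤ B.map g := tsub_le_iff_left.2 h
  obtain ⟨A', hA', hA'f⟩ := exists_of_le_map h1
  obtain ⟨B', hB', hB'g⟩ := exists_of_le_map h2
  refine ⟨A', hA', B', hB', ?_⟩
  rw [hA'f, hB'g, add_comm, Multiset.sub_add_inter]

/-- Parity excludes the single reflection. Then `b` copies of `v` among `2 * k` rotations give `b *
(v - u) = 0`, so `b = 0`, and there are too few copies of `u`. -/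
theorem not_hasProductOneSubseq_replicate [NeZero n] (hn : 3 ≤ n) {k : ℕ}
    (hk : n = 2 * k ∨ n = k) {u v y : ZMod n} (huv : IsUnit (v - u)) :
    ¬ HasProductOneSubseq ((Multiset.replicate (2 * k - 1) u + Multiset.replicate (n - 1) v).map
      DihedralGroup.r + ({y} : Multiset (ZMod n)).map DihedralGroup.sr) (2 * k) := by
  rintro ⟨T, hT, hTc, hTp⟩
  obtain ⟨A, hA, B, hB, rfl⟩ := exists_of_le_map_add_map hT
  have heven := even_card_of_isProductOne hTp
  have hBc := Multiset.card_le_card hB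
  rw [Multiset.card_singleton] at hBc
  have hB0 : B.card = 0 := by
    obtain ⟨c, hc⟩ := heven
    omega
  obtain rfl := Multiset.card_eq_zero.1 hB0
  simp only [Multiset.map_zero, add_zero, Multiset.card_map] at hTp hTc
  have hsum := sum_eq_zero_of_isProductOne hTp
  obtain ⟨X, hX, Y, hY, hXY⟩ := exists_of_le_map_add_map (f := id) (g := id) (T := A)
    (A := Multiset.replicate (2 * k - 1) u) (B := Multiset.replicate (n - 1) v) (by simpa using hA)
  obtain ⟨a, ha, rfl⟩ := Multiset.le_replicate_iff.1 hX
  obtain ⟨b, hb, rfl⟩ := Multiset.le_replicate_iff.1 hY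
  simp only [Multiset.map_id] at hXY
  subst hXY
  simp only [Multiset.sum_add, Multiset.sum_replicate, nsmul_eq_mul, Multiset.card_add,
    Multiset.card_replicate] at hsum hTc
  have hL : ((a + b : ℕ) : ZMod n) = 0 := by
    rw [hTc, ZMod.natCast_eq_zero_iff]
    rcases hk with h | h
    · exact h.dvd
    · exact h.dvd.mul_left 2
  push_cast at hL
  have hb0 : (b : ZMod n) * (v - u) = 0 := by linear_combination hsum - u * hL
  rw [huv.mul_left_eq_zero, ZMod.natCast_eq_zero_iff] at hb0
  have := Nat.eq_zero_of_dvd_of_lt hb0 (by omega)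
  omega

theorem prod_filter_ne_one {G : Type*} [Group G] [DecidableEq G] (l : List G) :
    (l.filter (· ≠ 1)).prod = l.prod := by
  induction l with
  | nil => rfl
  | cons a l ih =>
    by_cases h : a = 1
    · subst h
      simpa using ih
    · rw [List.filter_cons_of_pos (by simpa using h), List.prod_cons, List.prod_cons, ih]

/-- Length six and parity force exactly two reflections; the identities drop out, and two distinct
reflections never multiply to one. -/
theorem not_hasProductOneSubseq_three {B : Multiset (ZMod 3)} (hB : B.Nodup) (hB3 : B.card = 3) :
    ¬ HasProductOneSubseq ((Multiset.replicate 5 (0 : ZMod 3)).map DihedralGroup.r +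
      B.map DihedralGroup.sr) 6 := by
  rintro ⟨T, hT, hTc, hTp⟩
  obtain ⟨A', hA', B', hB', rfl⟩ := exists_of_le_map_add_map hT
  obtain ⟨a, ha, rfl⟩ := Multiset.le_replicate_iff.1 hA'
  obtain ⟨c, hc⟩ := even_card_of_isProductOne hTp
  have hB'c := Multiset.card_le_card hB'
  simp only [Multiset.card_add, Multiset.card_map, Multiset.card_replicate] at hTc
  have hB'2 : B'.card = 2 := by omega
  obtain ⟨l, hl, hp⟩ := hTp
  rw [← prod_filter_ne_one] at hp
  have hl' : ((l.filter (· ≠ 1) : List (DihedralGroup 3)) : Multiset (DihedralGroup 3)) =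
      B'.map DihedralGroup.sr := by
    rw [← Multiset.filter_coe, hl, Multiset.filter_add]
    rw [Multiset.filter_eq_nil.2, Multiset.filter_eq_self.2, zero_add]
    · intro x hx
      obtain ⟨i, -, rfl⟩ := Multiset.mem_map.1 hx
      exact fun h : DihedralGroup.sr i = 1 => by rw [← DihedralGroup.r_zero] at h; cases h
    · intro x hx
      obtain ⟨i, hi, rfl⟩ := Multiset.mem_map.1 hx
      rw [Multiset.eq_of_mem_replicate hi]
      simp
  obtain ⟨i, j, rfl⟩ := Multiset.card_eq_two.1 hB'2
  have hij : i ≠ j := by simpa using Multiset.nodup_of_le hB' hB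
  obtain ⟨p, q, hpq⟩ : ∃ p q, l.filter (· ≠ 1) = [p, q] :=
    List.length_eq_two.1 (by rw [← Multiset.coe_card, hl']; simp)
  rw [hpq] at hl' hp
  have hpqs : ({p, q} : Multiset (DihedralGroup 3)) = {.sr i, .sr j} :=
    hl'
  have hne : (DihedralGroup.sr i : DihedralGroup 3) * .sr j ≠ 1 ∧
      (DihedralGroup.sr j : DihedralGroup 3) * .sr i ≠ 1 := by
    rw [DihedralGroup.sr_mul_sr, DihedralGroup.sr_mul_sr, ← DihedralGroup.r_zero, ne_eq, ne_eq,
      DihedralGroup.r.injEq, DihedralGroup.r.injEq, sub_eq_zero, sub_eq_zero]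
    exact ⟨hij.symm, hij⟩
  simp only [List.prod_cons, List.prod_nil, mul_one] at hp
  rw [Multiset.insert_eq_cons, Multiset.insert_eq_cons] at hpqs
  rcases Multiset.cons_eq_cons.1 hpqs with ⟨rfl, h⟩ | ⟨-, R, h1, h2⟩
  · rw [Multiset.singleton_inj] at h
    subst h
    exact hne.1 hp
  · rw [Multiset.singleton_eq_cons_iff] at h1 h2
    obtain ⟨rfl, -⟩ := h1
    obtain ⟨rfl, -⟩ := h2
    exact hne.2 hp

end Extremal

/-! ### The dihedral presentation -/

section Presentation

open PresentedGroup

/-- The normal forms are closed under the group operations and contain the generators. They make the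
injectivity of the map to `DihedralGroup n` a check on two kinds of words. -/
theorem presented_cases (n : ℕ) (x : PresentedGroup (dihedralRels n)) :
    ∃ k : ℤ, x = of 0 ^ k ∨ x = of 1 * of 0 ^ k := by
  set a : PresentedGroup (dihedralRels n) := of 0 with ha
  set t : PresentedGroup (dihedralRels n) := of 1 with ht
  have ht2 : t * t = 1 := by
    rw [← pow_two]
    exact one_of_mem (rels := dihedralRels n) (by simp [dihedralRels])
  have hta : t * a * t⁻¹ = a⁻¹ := by
    have h : (t * a) * (a⁻¹ * t)⁻¹ = 1 :=
      one_of_mem (rels := dihedralRels n) (by simp [dihedralRels])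
    rw [mul_inv_eq_one] at h
    rw [h, mul_inv_cancel_right]
  have htz : ∀ k : ℤ, t * a ^ k = a ^ (-k) * t := by
    intro k
    rw [← mul_inv_eq_iff_eq_mul, ← conj_zpow, hta, inv_zpow, zpow_neg]
  have htinv : t⁻¹ = t := inv_eq_of_mul_eq_one_left ht2
  let H : Subgroup (PresentedGroup (dihedralRels n)) :=
    { carrier := {x | ∃ k : ℤ, x = a ^ k ∨ x = t * a ^ k}
      one_mem' := ⟨0, by simp⟩
      mul_mem' := by
        rintro x y ⟨k, rfl | rfl⟩ ⟨l, rfl | rfl⟩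
        · exact ⟨k + l, Or.inl (zpow_add _ _ _).symm⟩
        · refine ⟨-k + l, Or.inr ?_⟩
          rw [zpow_add, ← mul_assoc, ← mul_assoc, htz, neg_neg]
        · exact ⟨k + l, Or.inr (by rw [mul_assoc, zpow_add])⟩
        · refine ⟨-k + l, Or.inl ?_⟩
          rw [htz, mul_assoc, ← mul_assoc t t, ht2, one_mul, zpow_add]
      inv_mem' := by
        rintro x ⟨k, rfl | rfl⟩
        · exact ⟨-k, Or.inl (zpow_neg _ _).symm⟩
        · refine ⟨k, Or.inr ?_⟩
          rw [mul_inv_rev, ← zpow_neg, htinv, htz] }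
  exact generated_by _ H (by
    intro i
    fin_cases i
    · exact ⟨1, Or.inl (zpow_one _).symm⟩
    · exact ⟨0, Or.inr (by rw [zpow_zero, mul_one]; rfl)⟩) x

theorem lift_dihedralRels (n : ℕ) : ∀ x ∈ dihedralRels n,
    FreeGroup.lift ![(DihedralGroup.r 1 : DihedralGroup n), .sr 0] x = 1 := by
  intro x hx
  simp only [dihedralRels, Set.mem_insert_iff, Set.mem_singleton_iff] at hx
  rcases hx with rfl | rfl | rfl
  · simp
  · simp [pow_two]
  · simp

/-- The standard presentation of `DihedralGroup n`. -/
noncomputable def presentedEquiv (n : ℕ) :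
    PresentedGroup (dihedralRels n) ≃* DihedralGroup n :=
  MulEquiv.ofBijective (toGroup (lift_dihedralRels n)) (by
    have h0 : toGroup (lift_dihedralRels n) (of 0) = DihedralGroup.r 1 := toGroup.of _
    have h1 : toGroup (lift_dihedralRels n) (of 1) = DihedralGroup.sr 0 := toGroup.of _
    constructor
    · rw [injective_iff_map_eq_one]
      intro x hx
      obtain ⟨k, rfl | rfl⟩ := presented_cases n x
      · rw [map_zpow, h0, DihedralGroup.r_one_zpow, ← DihedralGroup.r_zero,
          DihedralGroup.r.injEq, ZMod.intCast_zmod_eq_zero_iff_dvd] at hx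
        obtain ⟨m, rfl⟩ := hx
        have : (of 0 : PresentedGroup (dihedralRels n)) ^ n = 1 :=
          one_of_mem (rels := dihedralRels n) (by simp [dihedralRels])
        rw [zpow_mul, zpow_natCast, this, one_zpow]
      · rw [map_mul, map_zpow, h0, h1, DihedralGroup.r_one_zpow, DihedralGroup.sr_mul_r] at hx
        cases hx
    · intro x
      cases x with
      | r i =>
        obtain ⟨k, rfl⟩ := ZMod.intCast_surjective i
        exact ⟨of 0 ^ k, by rw [map_zpow, h0, DihedralGroup.r_one_zpow]⟩
      | sr i =>
        obtain ⟨k, rfl⟩ := ZMod.intCast_surjective i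
        exact ⟨of 1 * of 0 ^ k, by
          rw [map_mul, map_zpow, h0, h1, DihedralGroup.r_one_zpow, DihedralGroup.sr_mul_r,
            zero_add]⟩)

theorem presentedEquiv_of_zero (n : ℕ) : presentedEquiv n (of 0) = DihedralGroup.r 1 := by
  have : toGroup (lift_dihedralRels n) (of 0) = DihedralGroup.r 1 := toGroup.of _
  exact this

theorem presentedEquiv_of_one (n : ℕ) : presentedEquiv n (of 1) = DihedralGroup.sr 0 := by
  have : toGroup (lift_dihedralRels n) (of 1) = DihedralGroup.sr 0 := toGroup.of _
  exact this

theorem isDihedralPresentation_iff {G : Type*} [Group G] {n : ℕ} {α τ : G} :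
    IsDihedralPresentation n α τ ↔
      ∃ e : DihedralGroup n ≃* G, e (.r 1) = α ∧ e (.sr 0) = τ := by
  constructor
  · rintro ⟨f, rfl, rfl⟩
    refine ⟨(presentedEquiv n).symm.trans f, ?_, ?_⟩
    · rw [← presentedEquiv_of_zero]; simp
    · rw [← presentedEquiv_of_one]; simp
  · rintro ⟨e, rfl, rfl⟩
    exact ⟨(presentedEquiv n).trans e, by simp [presentedEquiv_of_zero],
      by simp [presentedEquiv_of_one]⟩

end Presentation

/-! ### Transport to an arbitrary dihedral group -/

section Transport

variable {G H : Type*} [Group G] [Group H]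

theorem hasProductOneSubseq_map (e : G →* H) {S : Multiset G} {m : ℕ}
    (h : HasProductOneSubseq S m) : HasProductOneSubseq (S.map e) m := by
  obtain ⟨T, hT, hc, l, rfl, hl⟩ := h
  exact ⟨_, Multiset.map_le_map hT, by simpa using hc, l.map e, by simp,
    by rw [← map_list_prod, hl, map_one]⟩

theorem hasProductOneSubseq_map_iff (e : G ≃* H) {S : Multiset G} {m : ℕ} :
    HasProductOneSubseq (S.map e) m ↔ HasProductOneSubseq S m := by
  refine ⟨fun h => ?_, fun h => hasProductOneSubseq_map e.toMonoidHom h⟩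
  have := hasProductOneSubseq_map e.symm.toMonoidHom h
  simpa [Multiset.map_map] using this

theorem sInf_eq_of_extremal {m ℓ : ℕ}
    (hup : ∀ S : Multiset G, ℓ ≤ S.card → HasProductOneSubseq S m)
    (hlow : ∃ S : Multiset G, S.card + 1 = ℓ ∧ ¬ HasProductOneSubseq S m) :
    sInf {ℓ : ℕ | ∀ S : Multiset G, ℓ ≤ S.card → HasProductOneSubseq S m} = ℓ := by
  refine le_antisymm (Nat.sInf_le hup) (le_csInf ⟨ℓ, hup⟩ fun b hb => ?_)
  obtain ⟨S, hS, hno⟩ := hlow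
  by_contra hlt
  exact hno (hb S (by omega))

theorem isUnit_val_sub_iff {n : ℕ} [NeZero n] {a b : ℕ} :
    IsUnit ((b : ZMod n) - a) ↔ Int.gcd ((a : ℤ) - b) n = 1 := by
  rw [← Int.isCoprime_iff_gcd_eq_one, ← IsCoprime.neg_left_iff, neg_sub, isCoprime_comm,
    ← ZMod.coe_int_isUnit_iff_isCoprime]
  push_cast
  rfl

theorem extremal_iff {n : ℕ} (hn : 3 ≤ n) {k : ℕ} (hk : n = 2 * k ∨ n = k)
    (e₀ : G ≃* DihedralGroup n) (S : Multiset G) :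
    (S.card + 1 = n + 2 * k ∧ ¬ HasProductOneSubseq S (2 * k)) ↔
      ∃ α τ : G, IsDihedralPresentation n α τ ∧
        ((∃ r₁ r₂ r₃ : ℕ, r₁ < n ∧ r₂ < n ∧ r₃ < n ∧ Int.gcd ((r₁ : ℤ) - (r₂ : ℤ)) (n : ℤ) = 1 ∧
            S = Multiset.replicate (2 * k - 1) (α ^ r₁) + Multiset.replicate (n - 1) (α ^ r₂)
              + {α ^ r₃ * τ}) ∨
          (n = 3 ∧ k = 3 ∧
            S = Multiset.replicate 5 (1 : G) + {τ} + {α * τ} + {α ^ 2 * τ})) := by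
  have : NeZero n := ⟨by omega⟩
  have hpow : ∀ (e : DihedralGroup n ≃* G) (i : ℕ), e (.r 1) ^ i = e (.r i) := by
    intro e i
    rw [← map_pow, DihedralGroup.r_one_pow]
  have hpow' : ∀ (e : DihedralGroup n ≃* G) (i : ℕ), e (.r 1) ^ i * e (.sr 0) = e (.sr (-i)) := by
    intro e i
    rw [hpow, ← map_mul, DihedralGroup.r_mul_sr, zero_sub]
  constructor
  · rintro ⟨hc, hno⟩
    obtain ⟨A, B, hAB⟩ := exists_map_r_add_map_sr (S.map e₀)
    have hS : S = (A.map DihedralGroup.r + B.map DihedralGroup.sr).map e₀.symm := by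
      rw [← hAB, Multiset.map_map]; simp
    rw [← hasProductOneSubseq_map_iff e₀, hAB] at hno
    have hcard : A.card + B.card = S.card := by rw [hS]; simp
    refine ⟨_, _, isDihedralPresentation_iff.2 ⟨e₀.symm, rfl, rfl⟩, ?_⟩
    rcases structure_of_not_hasProductOneSubseq hn hk (by omega) hno with
      ⟨u, v, y, huv, rfl, rfl⟩ | ⟨rfl, rfl, rfl, hB, hB3⟩
    · left
      -- The sign of `y` comes from `α ^ i * τ` corresponding to `sr (-i)`.
      refine ⟨u.val, v.val, (-y).val, u.val_lt, v.val_lt, (-y).val_lt, ?_, ?_⟩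
      · rw [← isUnit_val_sub_iff]
        simpa using huv
      · rw [hpow, hpow, hpow', hS]
        simp
    · right
      refine ⟨rfl, rfl, ?_⟩
      have hBu : B = {0} + {-1} + {-2} := by
        refine (Multiset.eq_of_le_of_card_le ((Multiset.le_iff_subset (by decide)).2 fun x _ => ?_)
          (by rw [hB3]; rfl)).symm
        have : (⟨B, hB⟩ : Finset (ZMod 3)) = Finset.univ :=
          Finset.eq_univ_of_card _ (by rw [ZMod.card]; exact hB3)
        have hx := Finset.mem_univ x
        rw [← this] at hx
        exact hx
      have h1 := hpow' e₀.symm 1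
      rw [pow_one] at h1
      rw [h1, hpow', hS, hBu]
      simp only [Multiset.map_add, Multiset.map_singleton, Multiset.map_replicate,
        DihedralGroup.r_zero, map_one, Nat.cast_one, Nat.cast_ofNat, add_assoc]
  · rintro ⟨α, τ, hατ, h⟩
    obtain ⟨e, rfl, rfl⟩ := isDihedralPresentation_iff.1 hατ
    rcases h with ⟨r₁, r₂, r₃, -, -, -, hgcd, rfl⟩ | ⟨rfl, rfl, rfl⟩
    · refine ⟨by simp; omega, ?_⟩
      have := not_hasProductOneSubseq_replicate hn hk (y := -(r₃ : ZMod n))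
        (isUnit_val_sub_iff.2 hgcd)
      rw [← hasProductOneSubseq_map_iff e] at this
      rw [hpow, hpow, hpow']
      simpa using this
    · refine ⟨by simp, ?_⟩
      have := not_hasProductOneSubseq_three (B := {0} + {-1} + {-2}) (by decide) rfl
      rw [← hasProductOneSubseq_map_iff e] at this
      have h1 := hpow' e 1
      rw [pow_one] at h1
      rw [h1, hpow']
      simpa only [Multiset.map_add, Multiset.map_singleton, Multiset.map_replicate,
        DihedralGroup.r_zero, map_one, Nat.cast_one, Nat.cast_ofNat, add_assoc] using this

theorem sInf_eq {n : ℕ} (hn : 3 ≤ n) {k : ℕ} (hk : n = 2 * k ∨ n = k)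
    (e₀ : G ≃* DihedralGroup n) :
    sInf {ℓ : ℕ | ∀ S : Multiset G, ℓ ≤ S.card → HasProductOneSubseq S (2 * k)} = n + 2 * k := by
  have : NeZero n := ⟨by omega⟩
  refine sInf_eq_of_extremal (fun S hS => ?_) ?_
  · rw [← hasProductOneSubseq_map_iff e₀]
    exact hasProductOneSubseq_of_card hn hk (by simpa using hS)
  · exact ⟨_, (extremal_iff hn hk e₀ _).2 ⟨_, _, isDihedralPresentation_iff.2 ⟨e₀.symm, rfl, rfl⟩,
      Or.inl ⟨0, 1, 0, by omega, by omega, by omega, by simp, rfl⟩⟩⟩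

end Transport

end DihedralEGZ

theorem theorem1p2 {G : Type*} [Group G] (n : ℕ) (hn : 3 ≤ n)
    (hG : Nonempty (G ≃* DihedralGroup n)) :
    -- Part 1: `n` even (hence `n ≥ 4`), product-one subsequences of length `exp(G) = n`
    (Even n →
      Monoid.exponent G = n ∧ egzS G = 2 * n ∧
      ∀ S : Multiset G,
        (S.card + 1 = egzS G ∧ ¬ HasProductOneSubseq S (Monoid.exponent G)) ↔
        ∃ α τ : G, IsDihedralPresentation n α τ ∧
          ∃ r₁ r₂ r₃ : ℕ, r₁ < n ∧ r₂ < n ∧ r₃ < n ∧ Int.gcd ((r₁ : ℤ) - (r₂ : ℤ)) (n : ℤ) = 1 ∧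
            S = Multiset.replicate (n - 1) (α ^ r₁) + Multiset.replicate (n - 1) (α ^ r₂)
              + {α ^ r₃ * τ}) ∧
    -- Part 2: product-one subsequences of length `|G| = 2n`
    (Nat.card G = 2 * n ∧ egzE G = 3 * n ∧
      ∀ S : Multiset G,
        (S.card + 1 = egzE G ∧ ¬ HasProductOneSubseq S (Nat.card G)) ↔
        ∃ α τ : G, IsDihedralPresentation n α τ ∧
          ((4 ≤ n ∧ ∃ r₁ r₂ r₃ : ℕ, r₁ < n ∧ r₂ < n ∧ r₃ < n ∧
              Int.gcd ((r₁ : ℤ) - (r₂ : ℤ)) (n : ℤ) = 1 ∧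
              S = Multiset.replicate (2 * n - 1) (α ^ r₁) + Multiset.replicate (n - 1) (α ^ r₂)
                + {α ^ r₃ * τ}) ∨
           (n = 3 ∧
              (S = Multiset.replicate 5 (1 : G) + {τ} + {α * τ} + {α ^ 2 * τ} ∨
               ∃ t₁ t₂ t₃ : ℕ, t₁ < 3 ∧ t₂ < 3 ∧ t₃ < 3 ∧
                Int.gcd ((t₁ : ℤ) - (t₂ : ℤ)) 3 = 1 ∧
                S = Multiset.replicate 5 (α ^ t₁) + Multiset.replicate 2 (α ^ t₂)
                  + {α ^ t₃ * τ})))) := by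
  obtain ⟨e₀⟩ := hG
  have hcard : Nat.card G = 2 * n := by
    rw [Nat.card_congr e₀.toEquiv, DihedralGroup.nat_card]
  refine ⟨fun heven => ?_, hcard, ?_⟩
  · obtain ⟨k, hk⟩ := heven.two_dvd
    have hexp : Monoid.exponent G = n := by
      rw [Monoid.exponent_eq_of_mulEquiv e₀, DihedralGroup.exponent]
      exact Nat.lcm_eq_left heven.two_dvd
    have hs : egzS G = 2 * n := by
      rw [egzS, hexp]
      have := DihedralEGZ.sInf_eq hn (Or.inl hk) e₀
      rw [← hk, ← two_mul] at this
      exact this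
    refine ⟨hexp, hs, fun S => ?_⟩
    have := DihedralEGZ.extremal_iff hn (Or.inl hk) e₀ S
    rw [← hk, ← two_mul] at this
    rw [hs, hexp, this]
    -- The exceptional alternative has `n = k = 3`, incompatible with `n = 2 * k`.
    refine exists_congr fun α => exists_congr fun τ => and_congr_right fun _ =>
      or_iff_left fun h => ?_
    omega
  · have hs : egzE G = 3 * n := by
      rw [egzE, hcard, DihedralEGZ.sInf_eq hn (Or.inr rfl) e₀]
      omega
    refine ⟨hs, fun S => ?_⟩
    rw [hs, hcard, show 3 * n = n + 2 * n by omega, DihedralEGZ.extremal_iff hn (Or.inr rfl) e₀ S]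
    refine exists_congr fun α => exists_congr fun τ => and_congr_right fun _ => ?_
    rcases hn.lt_or_eq with h4 | rfl
    · exact or_congr (iff_and_self.2 fun _ => h4) (by constructor <;> rintro ⟨h, -⟩ <;> omega)
    · constructor
      · rintro (⟨r₁, r₂, r₃, h⟩ | ⟨-, -, h⟩)
        · exact Or.inr ⟨rfl, Or.inr ⟨r₁, r₂, r₃, by simpa using h⟩⟩
        · exact Or.inr ⟨rfl, Or.inl h⟩
      · rintro (⟨h, -⟩ | ⟨-, h | ⟨r₁, r₂, r₃, h⟩⟩)
        · omega
        · exact Or.inr ⟨rfl, rfl, h⟩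
        · exact Or.inl ⟨r₁, r₂, r₃, by simpa using h⟩
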